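/- Let $r>1$ be an odd integer, let $m$ be an odd integer coprime to $r$, and put $r'=\frac{r-1}{2}$, $q=e^{m\pi i/r}$, and $q^x=e^{xm\pi i/r}$ for $x\in\mathbb{C}$ or $x\in\mathbb{C}/2r\mathbb{Z}$. Let $\bar U_q(\mathfrak{sl}_2)$ be the $\mathbb{C}$-algebra with generators $E,F,K,K^{-1}$ and relations $$KK^{-1}=K^{-1}K=1,\quad KEK^{-1}=q^2E,\quad KFK^{-1}=q^{-2}F,\quad [E,F]=\frac{K-K^{-1}}{q-q^{-1}},\quad E^r=F^r=0,$$ and let $\bar U_q^H(\mathfrak{sl}_2)$ be the $\mathbb{C}$-algebra with one more generator $H$ and the further relations $HK^{\pm1}=K^{\pm1}H$, $[H,E]=2E$, $[H,F]=-2F$. Both are bialgebras with $\Delta(E)=1\otimes E+E\otimes K$, $\Delta(F)=K^{-1}\otimes F+F\otimes 1$, $\Delta(K^{\pm1})=K^{\pm1}\otimes K^{\pm1}$, $\Delta(H)=H\otimes1+1\otimes H$, $\varepsilon(E)=\varepsilon(F)=\varepsilon(H)=0$, $\varepsilon(K^{\pm1})=1$. Let $\mathcal{C}^H$ be the tensor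 category of finite-dimensional $\bar U_q^H(\mathfrak{sl}_2)$-modules on which $H$ is diagonalizable and $K=q^H$; let $\mathcal{C}$ be the tensor category of finite-dimensional $\bar U_q(\mathfrak{sl}_2)$-modules on which $K$ is diagonalizable; and let $\varphi:\mathcal{C}^H\to\mathcal{C}$ be the functor that forgets the action of $H$. In both categories $\mathbb{I}=\mathbb{C}$ is the unit object. For $i\in\mathbb{C}$ let $V_i\in\mathcal{C}^H$ be the simple module of highest weight $i+r-1$, that is, generated by a vector $v_i\neq 0$ with $Ev_i=0$ and $Hv_i=(i+r-1)v_i$. For $\tilde\imath\in\mathbb{C}/2r\mathbb{Z}$ let $V_{\tilde\imath}\in\mathcal{C}$ be the highest weight module of highest weight $\tilde\imath+\widetilde{r-1}$, that is, generated by a vector $v_{\tilde\imath}\ne0$ with $Ev_{\tilde\imath}=0$ and $Kv_{\tilde\imath}=q^{\tilde\imath+\widetilde{r-1}}v_{\tilde\imath}$; here $\tilde x$ is the class of $x$ in $\mathbb{C}/2r\mathbb{Z}$. Set $H^{ijk}=\operatorname{Hom}_{\mathcal{C}^H}(\mathbb{I},V_i\otimes V_j\otimes V_k)$. Let $i,j,k\in\mathbb{C}\setminus\mathbb{Z}$,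 and assume for each $x\in\{i,j,k\}$ that if $mx$ is an integer, then it is divisible by $r$ (for $m=\pm1$ this holds automatically). Then: 1. For each $x\in\{i,j,k\}$ there is exactly one isomorphism $\varphi(V_x)\to V_{\tilde x}$ in $\mathcal{C}$ that carries $v_x$ to $v_{\tilde x}$. 2. If the height $i+j+k$ does not belong to $\{-2r',-2r'+2,\dots,2r'\}$, then $H^{ijk}=0$. 3. If $i+j+k\in\{-2r',-2r'+2,\dots,2r'\}$, then $H^{ijk}$ is one-dimensional, and the composition $$H^{ijk}\xrightarrow{\ \varphi\ }\operatorname{Hom}_{\mathcal{C}}(\mathbb{I},\varphi(V_i)\otimes\varphi(V_j)\otimes\varphi(V_k))\longrightarrow\operatorname{Hom}_{\mathcal{C}}(\mathbb{I},V_{\tilde\imath}\otimes V_{\tilde\jmath}\otimes V_{\tilde k}),$$ whose second map is induced by the isomorphisms of (1), is an isomorphism of vector spaces. -/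

import Mathlib

open scoped TensorProduct

noncomputable section

namespace QuantumSl2

/-! ### The root of unity -/

/-- An odd integer `r > 1` and an odd integer `m` coprime to `r`;
they determine the root of unity `q = exp (m π i / r)`, of order `2 r`. -/
structure RootData where
  r : ℕ
  m : ℤ
  one_lt : 1 < r
  odd_r : Odd r
  odd_m : Odd m
  coprime : IsCoprime m (r : ℤ)

namespace RootData

variable (P : RootData)

/-- `q ^ x = exp (x m π i / r)` for a complex number `x`. -/
def qpow (x : ℂ) : ℂ := Complex.exp (x * P.m * Real.pi * Complex.I / P.r)

/-- `q = exp (m π i / r)`. -/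
def q : ℂ := P.qpow 1

/-- `r' = (r - 1) / 2`; the division is exact because `r` is odd. -/
def r' : ℕ := (P.r - 1) / 2

/-- The set `{-2r', -2r' + 2, …, 2r'}` of complex numbers. -/
def heights : Set ℂ := {h | ∃ l : ℤ, -(P.r' : ℤ) ≤ l ∧ l ≤ (P.r' : ℤ) ∧ h = 2 * (l : ℂ)}

/-- The admissible labels: `i ∈ ℂ ∖ ℤ` such that `m i`, if it is an integer at all, is divisible
by `r`. For `m = 1` and `m = -1` the second condition follows from the first. -/
def Label (i : ℂ) : Prop :=
  (∀ n : ℤ, i ≠ n) ∧ ∀ n : ℤ, (P.m : ℂ) * i = n → (P.r : ℤ) ∣ n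

lemma r_ne_zero : (P.r : ℂ) ≠ 0 := by
  have := P.one_lt
  exact_mod_cast (by omega : P.r ≠ 0)

lemma q_ne_zero : P.q ≠ 0 := Complex.exp_ne_zero _

lemma qpow_periodic : Function.Periodic P.qpow (2 * P.r : ℂ) := by
  intro x
  unfold qpow
  have h : (x + 2 * P.r) * P.m * Real.pi * Complex.I / P.r
      = x * P.m * Real.pi * Complex.I / P.r + P.m * (2 * Real.pi * Complex.I) := by
    field_simp [P.r_ne_zero]
  rw [h, Complex.exp_add, Complex.exp_int_mul_two_pi_mul_I, mul_one]

/-- The group `ℂ / 2rℤ`, in which weights of modules without an action of `H` live. -/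
abbrev WeightGroup : Type := ℂ ⧸ AddSubgroup.zmultiples (2 * P.r : ℂ)

/-- The class of a complex number in `ℂ / 2rℤ`. -/
def tilde (x : ℂ) : P.WeightGroup := QuotientAddGroup.mk x

/-- `q ^ x` for `x ∈ ℂ / 2rℤ`. -/
def qpowTilde : P.WeightGroup → ℂ := P.qpow_periodic.lift

lemma isPrimitiveRoot_q_sq : IsPrimitiveRoot (P.q ^ 2) P.r := by
  have h0 : P.r ≠ 0 := by have := P.one_lt; omega
  have h := (Complex.isPrimitiveRoot_exp P.r h0).zpow_of_gcd_eq_one P.m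
    (Int.isCoprime_iff_gcd_eq_one.mp P.coprime)
  have e : P.q ^ 2 = Complex.exp (2 * Real.pi * Complex.I / P.r) ^ P.m := by
    unfold q qpow
    rw [← Complex.exp_nat_mul, ← Complex.exp_int_mul]
    congr 1
    push_cast
    ring
  rw [e]
  exact h

end RootData

/-! ### Powers of a sum of two `p`-commuting elements -/

/-- Gaussian binomial coefficients. -/
def gauss (p : ℂ) : ℕ → ℕ → ℂ
  | _, 0 => 1
  | 0, _ + 1 => 0
  | n + 1, j + 1 => gauss p n j + p ^ (j + 1) * gauss p n (j + 1)

lemma gauss_zero_right (p : ℂ) (n : ℕ) : gauss p n 0 = 1 := by cases n <;> rfl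

lemma gauss_eq_zero (p : ℂ) : ∀ n j : ℕ, n < j → gauss p n j = 0
  | 0, 0, h => by omega
  | 0, j + 1, _ => rfl
  | n + 1, 0, h => by omega
  | n + 1, j + 1, h => by
    rw [gauss, gauss_eq_zero p n j (by omega), gauss_eq_zero p n (j + 1) (by omega)]; simp

lemma gauss_self (p : ℂ) : ∀ n : ℕ, gauss p n n = 1
  | 0 => rfl
  | n + 1 => by rw [gauss, gauss_self p n, gauss_eq_zero p n (n + 1) (by omega)]; simp

lemma gauss_step (p : ℂ) : ∀ n j : ℕ, j ≤ n →
    (1 - p ^ (j + 1)) * gauss p n (j + 1) = (1 - p ^ (n - j)) * gauss p n j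
  | 0, 0, _ => by simp [gauss]
  | n + 1, 0, _ => by
    have h := gauss_step p n 0 (by omega)
    simp only [gauss, gauss_zero_right, Nat.sub_zero, zero_add] at h ⊢
    linear_combination p * h
  | n + 1, j + 1, hj => by
    rcases Nat.lt_or_ge j n with hjn | hjn
    · obtain ⟨d, rfl⟩ : ∃ d, n = j + 1 + d := ⟨n - (j + 1), by omega⟩
      have h1 := gauss_step p (j + 1 + d) j (by omega)
      have h2 := gauss_step p (j + 1 + d) (j + 1) (by omega)
      have e1 : j + 1 + d - j = d + 1 := by omega
      have e2 : j + 1 + d - (j + 1) = d := by omega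
      have e3 : j + 1 + d + 1 - (j + 1) = d + 1 := by omega
      rw [e1] at h1
      rw [e2] at h2
      rw [e3]
      simp only [gauss]
      linear_combination h1 + p ^ (j + 2) * h2
    · have : j = n := by omega
      subst this
      simp [gauss_eq_zero]

lemma gauss_vanish {p : ℂ} {r : ℕ} (hp : IsPrimitiveRoot p r) :
    ∀ j : ℕ, 0 < j → j < r → gauss p r j = 0
  | 0, h, _ => by omega
  | j + 1, _, h => by
    have h1 : (1 - p ^ (j + 1)) ≠ 0 :=
      sub_ne_zero.mpr (Ne.symm (hp.pow_ne_one_of_pos_of_lt (by omega) h))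
    have h2 := gauss_step p r j (by omega)
    rcases Nat.eq_zero_or_pos j with rfl | hj
    · rw [Nat.sub_zero, hp.pow_eq_one, sub_self, zero_mul] at h2
      exact (mul_eq_zero.mp h2).resolve_left h1
    · rw [gauss_vanish hp j hj (by omega), mul_zero] at h2
      exact (mul_eq_zero.mp h2).resolve_left h1

lemma pow_mul_comm_q {R : Type*} [Ring R] [Algebra ℂ R] {p : ℂ} {X Y : R}
    (h : Y * X = p • (X * Y)) : ∀ j : ℕ, Y * X ^ j = p ^ j • (X ^ j * Y)
  | 0 => by simp
  | j + 1 => by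
    rw [pow_succ, ← mul_assoc, pow_mul_comm_q h j, smul_mul_assoc, mul_assoc, h,
      mul_smul_comm, smul_smul, mul_assoc, pow_succ]

lemma add_pow_gauss {R : Type*} [Ring R] [Algebra ℂ R] {p : ℂ} {X Y : R}
    (h : Y * X = p • (X * Y)) (n : ℕ) :
    (X + Y) ^ n = ∑ j ∈ Finset.range (n + 1), gauss p n j • (X ^ j * Y ^ (n - j)) := by
  induction n with
  | zero => simp [gauss]
  | succ n ih =>
    rw [pow_succ', ih, add_mul, Finset.mul_sum, Finset.mul_sum]
    have hX : ∀ j ∈ Finset.range (n + 1), X * gauss p n j • (X ^ j * Y ^ (n - j))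
        = gauss p n j • (X ^ (j + 1) * Y ^ (n + 1 - (j + 1))) := by
      intro j _
      rw [mul_smul_comm, ← mul_assoc, ← pow_succ', Nat.add_sub_add_right]
    have hY : ∀ j ∈ Finset.range (n + 1), Y * gauss p n j • (X ^ j * Y ^ (n - j))
        = (p ^ j * gauss p n j) • (X ^ j * Y ^ (n + 1 - j)) := by
      intro j hj
      have hj' : n + 1 - j = (n - j) + 1 := by
        have := Finset.mem_range.mp hj; omega
      rw [mul_smul_comm, ← mul_assoc, pow_mul_comm_q h, smul_mul_assoc, smul_smul, mul_assoc,
        ← pow_succ', hj', mul_comm]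
    rw [Finset.sum_congr rfl hX, Finset.sum_congr rfl hY,
      Finset.sum_range_succ' (fun j => gauss p (n + 1) j • (X ^ j * Y ^ (n + 1 - j)))]
    simp only [gauss, add_smul, Finset.sum_add_distrib]
    rw [add_assoc]
    congr 1
    rw [Finset.sum_range_succ' (fun j => (p ^ j * gauss p n j) • (X ^ j * Y ^ (n + 1 - j))),
      Finset.sum_range_succ (fun j => (p ^ (j + 1) * gauss p n (j + 1)) •
        (X ^ (j + 1) * Y ^ (n + 1 - (j + 1))))]
    simp [gauss_eq_zero, gauss_zero_right]

lemma add_pow_root {R : Type*} [Ring R] [Algebra ℂ R] {p : ℂ} {r : ℕ} (hr : 0 < r)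
    (hp : IsPrimitiveRoot p r) {X Y : R} (h : Y * X = p • (X * Y)) :
    (X + Y) ^ r = X ^ r + Y ^ r := by
  rw [add_pow_gauss h, Finset.sum_range_succ, ← Nat.succ_pred_eq_of_pos hr, Finset.sum_range_succ',
    Finset.sum_eq_zero]
  · simp [gauss_zero_right, gauss_self, add_comm]
  · intro j hj
    have hj' := Finset.mem_range.mp hj
    have : gauss p (r.pred.succ) (j + 1) = 0 := by
      rw [Nat.succ_pred_eq_of_pos hr]
      exact gauss_vanish hp _ (by omega) (by simp at hj'; omega)
    rw [this, zero_smul]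

/-! ### The Hopf algebra `Ū_q(sl₂)` -/

/-- Generators of `Ū_q(sl₂)`; `Ki` stands for `K⁻¹`. -/
inductive Gen
  | E | F | K | Ki

/-- The defining relations of `Ū_q(sl₂)`. -/
inductive Rel (P : RootData) : FreeAlgebra ℂ Gen → FreeAlgebra ℂ Gen → Prop
  | K_Ki : Rel P (FreeAlgebra.ι ℂ Gen.K * FreeAlgebra.ι ℂ Gen.Ki) 1
  | Ki_K : Rel P (FreeAlgebra.ι ℂ Gen.Ki * FreeAlgebra.ι ℂ Gen.K) 1
  | K_E : Rel P (FreeAlgebra.ι ℂ Gen.K * FreeAlgebra.ι ℂ Gen.E * FreeAlgebra.ι ℂ Gen.Ki)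
      (P.q ^ 2 • FreeAlgebra.ι ℂ Gen.E)
  | K_F : Rel P (FreeAlgebra.ι ℂ Gen.K * FreeAlgebra.ι ℂ Gen.F * FreeAlgebra.ι ℂ Gen.Ki)
      ((P.q ^ 2)⁻¹ • FreeAlgebra.ι ℂ Gen.F)
  | E_F : Rel P (FreeAlgebra.ι ℂ Gen.E * FreeAlgebra.ι ℂ Gen.F
        - FreeAlgebra.ι ℂ Gen.F * FreeAlgebra.ι ℂ Gen.E)
      ((P.q - P.q⁻¹)⁻¹ • (FreeAlgebra.ι ℂ Gen.K - FreeAlgebra.ι ℂ Gen.Ki))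
  | E_pow : Rel P (FreeAlgebra.ι ℂ Gen.E ^ P.r) 0
  | F_pow : Rel P (FreeAlgebra.ι ℂ Gen.F ^ P.r) 0

/-- The algebra `Ū_q(sl₂)`. -/
def U (P : RootData) : Type := RingQuot (Rel P)

instance (P : RootData) : Ring (U P) := inferInstanceAs (Ring (RingQuot (Rel P)))
instance (P : RootData) : Algebra ℂ (U P) := inferInstanceAs (Algebra ℂ (RingQuot (Rel P)))

/-! ### The Hopf algebra `Ū_q^H(sl₂)` -/

/-- Generators of `Ū_q^H(sl₂)`; `Ki` stands for `K⁻¹`. -/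
inductive GenH
  | E | F | K | Ki | H

/-- The defining relations of `Ū_q^H(sl₂)`. -/
inductive RelH (P : RootData) : FreeAlgebra ℂ GenH → FreeAlgebra ℂ GenH → Prop
  | K_Ki : RelH P (FreeAlgebra.ι ℂ GenH.K * FreeAlgebra.ι ℂ GenH.Ki) 1
  | Ki_K : RelH P (FreeAlgebra.ι ℂ GenH.Ki * FreeAlgebra.ι ℂ GenH.K) 1
  | K_E : RelH P (FreeAlgebra.ι ℂ GenH.K * FreeAlgebra.ι ℂ GenH.E * FreeAlgebra.ι ℂ GenH.Ki)
      (P.q ^ 2 • FreeAlgebra.ι ℂ GenH.E)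
  | K_F : RelH P (FreeAlgebra.ι ℂ GenH.K * FreeAlgebra.ι ℂ GenH.F * FreeAlgebra.ι ℂ GenH.Ki)
      ((P.q ^ 2)⁻¹ • FreeAlgebra.ι ℂ GenH.F)
  | E_F : RelH P (FreeAlgebra.ι ℂ GenH.E * FreeAlgebra.ι ℂ GenH.F
        - FreeAlgebra.ι ℂ GenH.F * FreeAlgebra.ι ℂ GenH.E)
      ((P.q - P.q⁻¹)⁻¹ • (FreeAlgebra.ι ℂ GenH.K - FreeAlgebra.ι ℂ GenH.Ki))
  | E_pow : RelH P (FreeAlgebra.ι ℂ GenH.E ^ P.r) 0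
  | F_pow : RelH P (FreeAlgebra.ι ℂ GenH.F ^ P.r) 0
  | H_K : RelH P (FreeAlgebra.ι ℂ GenH.H * FreeAlgebra.ι ℂ GenH.K)
      (FreeAlgebra.ι ℂ GenH.K * FreeAlgebra.ι ℂ GenH.H)
  | H_Ki : RelH P (FreeAlgebra.ι ℂ GenH.H * FreeAlgebra.ι ℂ GenH.Ki)
      (FreeAlgebra.ι ℂ GenH.Ki * FreeAlgebra.ι ℂ GenH.H)
  | H_E : RelH P (FreeAlgebra.ι ℂ GenH.H * FreeAlgebra.ι ℂ GenH.E
        - FreeAlgebra.ι ℂ GenH.E * FreeAlgebra.ι ℂ GenH.H)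
      ((2 : ℂ) • FreeAlgebra.ι ℂ GenH.E)
  | H_F : RelH P (FreeAlgebra.ι ℂ GenH.H * FreeAlgebra.ι ℂ GenH.F
        - FreeAlgebra.ι ℂ GenH.F * FreeAlgebra.ι ℂ GenH.H)
      (-(2 : ℂ) • FreeAlgebra.ι ℂ GenH.F)

/-- The algebra `Ū_q^H(sl₂)`. -/
def UH (P : RootData) : Type := RingQuot (RelH P)

instance (P : RootData) : Ring (UH P) := inferInstanceAs (Ring (RingQuot (RelH P)))
instance (P : RootData) : Algebra ℂ (UH P) := inferInstanceAs (Algebra ℂ (RingQuot (RelH P)))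

/-! ### Universal properties -/

/-- Elements `E, F, K, K⁻¹` of an algebra that satisfy the relations of `Ū_q(sl₂)`. -/
structure Quad (P : RootData) (R : Type*) [Ring R] [Algebra ℂ R] where
  E : R
  F : R
  K : R
  Ki : R
  K_Ki : K * Ki = 1
  Ki_K : Ki * K = 1
  K_E : K * E * Ki = P.q ^ 2 • E
  K_F : K * F * Ki = (P.q ^ 2)⁻¹ • F
  E_F : E * F - F * E = (P.q - P.q⁻¹)⁻¹ • (K - Ki)
  E_pow : E ^ P.r = 0
  F_pow : F ^ P.r = 0

namespace Quad

variable {P : RootData} {R : Type*} [Ring R] [Algebra ℂ R]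

lemma KE (s : Quad P R) : s.K * s.E = P.q ^ 2 • (s.E * s.K) := by
  rw [← smul_mul_assoc, ← s.K_E, mul_assoc _ s.Ki, s.Ki_K, mul_one]

lemma FKi (s : Quad P R) : s.Ki * s.F = P.q ^ 2 • (s.F * s.Ki) := by
  have h := congrArg (fun x => s.Ki * x) s.K_F
  simp only [← mul_assoc, s.Ki_K, one_mul, mul_smul_comm] at h
  rw [h, smul_smul, mul_inv_cancel₀ (pow_ne_zero 2 P.q_ne_zero), one_smul]

lemma KF (s : Quad P R) : s.K * s.F = (P.q ^ 2)⁻¹ • (s.F * s.K) := by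
  rw [← smul_mul_assoc, ← s.K_F, mul_assoc _ s.Ki, s.Ki_K, mul_one]

lemma EKi (s : Quad P R) : s.Ki * s.E = (P.q ^ 2)⁻¹ • (s.E * s.Ki) := by
  have h := congrArg (fun x => s.Ki * x) s.K_E
  simp only [← mul_assoc, s.Ki_K, one_mul, mul_smul_comm] at h
  rw [h, smul_smul, inv_mul_cancel₀ (pow_ne_zero 2 P.q_ne_zero), one_smul]

/-- The coproduct formulas
`Δ E = 1 ⊗ E + E ⊗ K`, `Δ F = K⁻¹ ⊗ F + F ⊗ 1`, `Δ K = K ⊗ K`, `Δ K⁻¹ = K⁻¹ ⊗ K⁻¹`. -/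
def delta (s : Quad P R) : Quad P (R ⊗[ℂ] R) where
  E := 1 ⊗ₜ s.E + s.E ⊗ₜ s.K
  F := s.Ki ⊗ₜ s.F + s.F ⊗ₜ 1
  K := s.K ⊗ₜ s.K
  Ki := s.Ki ⊗ₜ s.Ki
  K_Ki := by simp [s.K_Ki, Algebra.TensorProduct.one_def]
  Ki_K := by simp [s.Ki_K, Algebra.TensorProduct.one_def]
  K_E := by
    simp only [mul_add, add_mul, Algebra.TensorProduct.tmul_mul_tmul, mul_one, s.K_Ki, s.K_E,
      smul_add, TensorProduct.tmul_smul, TensorProduct.smul_tmul']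
    simp [mul_assoc, s.K_Ki]
  K_F := by
    simp only [mul_add, add_mul, Algebra.TensorProduct.tmul_mul_tmul, mul_one, s.K_Ki, s.K_F,
      smul_add, TensorProduct.tmul_smul, TensorProduct.smul_tmul', one_mul]
  E_F := by
    have h1 : s.E * s.F = s.F * s.E + (P.q - P.q⁻¹)⁻¹ • (s.K - s.Ki) := by
      rw [← s.E_F]; abel
    have hc : (P.q ^ 2)⁻¹ * P.q ^ 2 = 1 := inv_mul_cancel₀ (pow_ne_zero 2 P.q_ne_zero)
    simp only [mul_add, add_mul, Algebra.TensorProduct.tmul_mul_tmul, mul_one, one_mul]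
    rw [s.KF, s.EKi, h1]
    simp only [TensorProduct.tmul_add, TensorProduct.add_tmul, TensorProduct.tmul_sub,
      TensorProduct.sub_tmul, TensorProduct.tmul_smul, ← TensorProduct.smul_tmul', smul_sub]
    abel
  E_pow := by
    have hr : 0 < P.r := by have := P.one_lt; omega
    rw [add_pow_root hr P.isPrimitiveRoot_q_sq]
    · simp [Algebra.TensorProduct.tmul_pow, s.E_pow]
    · simp [s.KE]
  F_pow := by
    have hr : 0 < P.r := by have := P.one_lt; omega
    rw [add_comm, add_pow_root hr P.isPrimitiveRoot_q_sq]
    · simp [Algebra.TensorProduct.tmul_pow, s.F_pow]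
    · simp only [Algebra.TensorProduct.tmul_mul_tmul, mul_one, one_mul]
      rw [s.FKi, TensorProduct.smul_tmul']

/-- The counit formulas `ε E = ε F = 0`, `ε K = ε K⁻¹ = 1`. -/
def eps (P : RootData) : Quad P ℂ where
  E := 0
  F := 0
  K := 1
  Ki := 1
  K_Ki := by simp
  Ki_K := by simp
  K_E := by simp
  K_F := by simp
  E_F := by simp
  E_pow := by have := P.one_lt; simp; omega
  F_pow := by have := P.one_lt; simp; omega

/-- The values of a quadruple on the generators. -/
def val (s : Quad P R) : Gen → R
  | Gen.E => s.E
  | Gen.F => s.F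
  | Gen.K => s.K
  | Gen.Ki => s.Ki

end Quad

/-- Elements `E, F, K, K⁻¹, H` of an algebra that satisfy the relations of `Ū_q^H(sl₂)`. -/
structure Quint (P : RootData) (R : Type*) [Ring R] [Algebra ℂ R] extends Quad P R where
  H : R
  H_K : H * K = K * H
  H_Ki : H * Ki = Ki * H
  H_E : H * E - E * H = (2 : ℂ) • E
  H_F : H * F - F * H = -(2 : ℂ) • F

namespace Quint

variable {P : RootData} {R : Type*} [Ring R] [Algebra ℂ R]

/-- The coproduct formulas, with `Δ H = H ⊗ 1 + 1 ⊗ H`. -/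
def delta (s : Quint P R) : Quint P (R ⊗[ℂ] R) where
  toQuad := s.toQuad.delta
  H := s.H ⊗ₜ 1 + 1 ⊗ₜ s.H
  H_K := by simp [Quad.delta, mul_add, add_mul, s.H_K]
  H_Ki := by simp [Quad.delta, mul_add, add_mul, s.H_Ki]
  H_E := by
    have h1 : s.H * s.E = s.E * s.H + (2 : ℂ) • s.E := by rw [← s.H_E]; abel
    simp only [Quad.delta, mul_add, add_mul, Algebra.TensorProduct.tmul_mul_tmul, mul_one,
      one_mul, h1, s.H_K, TensorProduct.tmul_add, TensorProduct.add_tmul, smul_add,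
      TensorProduct.tmul_smul, TensorProduct.smul_tmul']
    abel
  H_F := by
    have h1 : s.H * s.F = s.F * s.H + -(2 : ℂ) • s.F := by rw [← s.H_F]; abel
    simp only [Quad.delta, mul_add, add_mul, Algebra.TensorProduct.tmul_mul_tmul, mul_one,
      one_mul, h1, s.H_Ki, TensorProduct.tmul_add, TensorProduct.add_tmul, smul_add,
      TensorProduct.tmul_smul, TensorProduct.smul_tmul']
    abel

/-- The counit formulas, with `ε H = 0`. -/
def eps (P : RootData) : Quint P ℂ where
  toQuad := Quad.eps P
  H := 0
  H_K := by simp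
  H_Ki := by simp
  H_E := by simp [Quad.eps]
  H_F := by simp [Quad.eps]

/-- The values of a quintuple on the generators. -/
def val (s : Quint P R) : GenH → R
  | GenH.E => s.E
  | GenH.F => s.F
  | GenH.K => s.K
  | GenH.Ki => s.Ki
  | GenH.H => s.H

end Quint

namespace U

variable (P : RootData)

/-- The class of a generator. -/
def gen (g : Gen) : U P := RingQuot.mkAlgHom ℂ (Rel P) (FreeAlgebra.ι ℂ g)

/-- The generators satisfy the relations. -/
def quad : Quad P (U P) where
  E := gen P Gen.E
  F := gen P Gen.F
  K := gen P Gen.K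
  Ki := gen P Gen.Ki
  K_Ki := by simpa using! RingQuot.mkAlgHom_rel ℂ (Rel.K_Ki (P := P))
  Ki_K := by simpa using! RingQuot.mkAlgHom_rel ℂ (Rel.Ki_K (P := P))
  K_E := by simpa using! RingQuot.mkAlgHom_rel ℂ (Rel.K_E (P := P))
  K_F := by simpa using! RingQuot.mkAlgHom_rel ℂ (Rel.K_F (P := P))
  E_F := by simpa using! RingQuot.mkAlgHom_rel ℂ (Rel.E_F (P := P))
  E_pow := by simpa using! RingQuot.mkAlgHom_rel ℂ (Rel.E_pow (P := P))
  F_pow := by simpa using! RingQuot.mkAlgHom_rel ℂ (Rel.F_pow (P := P))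

variable {P} {R : Type*} [Ring R] [Algebra ℂ R]

/-- The algebra homomorphism out of `Ū_q(sl₂)` with prescribed values on the generators. -/
def lift (s : Quad P R) : U P →ₐ[ℂ] R :=
  RingQuot.liftAlgHom ℂ ⟨FreeAlgebra.lift ℂ s.val, by
    intro x y h
    induction h with
    | K_Ki => simpa [Quad.val] using s.K_Ki
    | Ki_K => simpa [Quad.val] using s.Ki_K
    | K_E => simpa [Quad.val] using s.K_E
    | K_F => simpa [Quad.val] using s.K_F
    | E_F => simpa [Quad.val] using s.E_F
    | E_pow => simpa [Quad.val] using s.E_pow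
    | F_pow => simpa [Quad.val] using s.F_pow⟩

@[simp] lemma lift_gen (s : Quad P R) (g : Gen) : lift s (gen P g) = s.val g := by
  unfold lift gen
  exact (RingQuot.liftAlgHom_mkAlgHom_apply ℂ _ _ _).trans (FreeAlgebra.lift_ι_apply _ _)

lemma hom_ext {f g : U P →ₐ[ℂ] R} (h : ∀ x, f (gen P x) = g (gen P x)) : f = g := by
  apply RingQuot.ringQuot_ext'
  apply FreeAlgebra.hom_ext
  funext x
  exact h x

instance : Bialgebra ℂ (U P) :=
  Bialgebra.ofAlgHom (lift (quad P).delta) (lift (Quad.eps P))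
    (by
      apply hom_ext
      intro x
      cases x <;>
      simp [Quad.val, Quad.delta, quad, TensorProduct.tmul_add, TensorProduct.add_tmul,
        Algebra.TensorProduct.one_def, add_assoc])
    (by
      apply hom_ext
      intro x
      cases x <;>
      simp [Quad.val, Quad.delta, Quad.eps, quad])
    (by
      apply hom_ext
      intro x
      cases x <;>
      simp [Quad.val, Quad.delta, Quad.eps, quad])

end U

namespace UH

variable (P : RootData)

/-- The class of a generator. -/
def gen (g : GenH) : UH P := RingQuot.mkAlgHom ℂ (RelH P) (FreeAlgebra.ι ℂ g)

/-- The generators satisfy the relations. -/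
def quint : Quint P (UH P) where
  E := gen P GenH.E
  F := gen P GenH.F
  K := gen P GenH.K
  Ki := gen P GenH.Ki
  H := gen P GenH.H
  K_Ki := by simpa using! RingQuot.mkAlgHom_rel ℂ (RelH.K_Ki (P := P))
  Ki_K := by simpa using! RingQuot.mkAlgHom_rel ℂ (RelH.Ki_K (P := P))
  K_E := by simpa using! RingQuot.mkAlgHom_rel ℂ (RelH.K_E (P := P))
  K_F := by simpa using! RingQuot.mkAlgHom_rel ℂ (RelH.K_F (P := P))
  E_F := by simpa using! RingQuot.mkAlgHom_rel ℂ (RelH.E_F (P := P))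
  E_pow := by simpa using! RingQuot.mkAlgHom_rel ℂ (RelH.E_pow (P := P))
  F_pow := by simpa using! RingQuot.mkAlgHom_rel ℂ (RelH.F_pow (P := P))
  H_K := by simpa using! RingQuot.mkAlgHom_rel ℂ (RelH.H_K (P := P))
  H_Ki := by simpa using! RingQuot.mkAlgHom_rel ℂ (RelH.H_Ki (P := P))
  H_E := by simpa using! RingQuot.mkAlgHom_rel ℂ (RelH.H_E (P := P))
  H_F := by simpa using! RingQuot.mkAlgHom_rel ℂ (RelH.H_F (P := P))

variable {P} {R : Type*} [Ring R] [Algebra ℂ R]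

/-- The algebra homomorphism out of `Ū_q^H(sl₂)` with prescribed values on the generators. -/
def lift (s : Quint P R) : UH P →ₐ[ℂ] R :=
  RingQuot.liftAlgHom ℂ ⟨FreeAlgebra.lift ℂ s.val, by
    intro x y h
    induction h with
    | K_Ki => simpa [Quint.val] using s.K_Ki
    | Ki_K => simpa [Quint.val] using s.Ki_K
    | K_E => simpa [Quint.val] using s.K_E
    | K_F => simpa [Quint.val] using s.K_F
    | E_F => simpa [Quint.val] using s.E_F
    | E_pow => simpa [Quint.val] using s.E_pow
    | F_pow => simpa [Quint.val] using s.F_pow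
    | H_K => simpa [Quint.val] using s.H_K
    | H_Ki => simpa [Quint.val] using s.H_Ki
    | H_E => simpa [Quint.val] using s.H_E
    | H_F => simpa [Quint.val] using s.H_F⟩

@[simp] lemma lift_gen (s : Quint P R) (g : GenH) : lift s (gen P g) = s.val g := by
  unfold lift gen
  exact (RingQuot.liftAlgHom_mkAlgHom_apply ℂ _ _ _).trans (FreeAlgebra.lift_ι_apply _ _)

lemma hom_ext {f g : UH P →ₐ[ℂ] R} (h : ∀ x, f (gen P x) = g (gen P x)) : f = g := by
  apply RingQuot.ringQuot_ext'
  apply FreeAlgebra.hom_ext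
  funext x
  exact h x

instance : Bialgebra ℂ (UH P) :=
  Bialgebra.ofAlgHom (lift (quint P).delta) (lift (Quint.eps P))
    (by
      apply hom_ext
      intro x
      cases x <;>
      simp [Quint.val, Quint.delta, Quad.delta, quint, TensorProduct.tmul_add,
        TensorProduct.add_tmul, Algebra.TensorProduct.one_def, add_assoc])
    (by
      apply hom_ext
      intro x
      cases x <;>
      simp [Quint.val, Quint.delta, Quint.eps, Quad.delta, Quad.eps, quint])
    (by
      apply hom_ext
      intro x
      cases x <;>
      simp [Quint.val, Quint.delta, Quint.eps, Quad.delta, Quad.eps, quint])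

end UH

/-- The homomorphism `Ū_q(sl₂) → Ū_q^H(sl₂)` that sends generators to generators. -/
def incl (P : RootData) : U P →ₐ[ℂ] UH P := U.lift (UH.quint P).toQuad

lemma comul_incl (P : RootData) :
    (Bialgebra.comulAlgHom ℂ (UH P)).comp (incl P)
      = (Algebra.TensorProduct.map (incl P) (incl P)).comp (Bialgebra.comulAlgHom ℂ (U P)) := by
  apply U.hom_ext
  intro x
  change UH.lift (UH.quint P).delta (U.lift (UH.quint P).toQuad (U.gen P x))
    = Algebra.TensorProduct.map (incl P) (incl P) (U.lift (U.quad P).delta (U.gen P x))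
  cases x <;>
  simp [incl, Quad.val, Quint.val, Quint.delta, Quad.delta, UH.quint, U.quad]

lemma counit_incl (P : RootData) :
    (Bialgebra.counitAlgHom ℂ (UH P)).comp (incl P) = Bialgebra.counitAlgHom ℂ (U P) := by
  apply U.hom_ext
  intro x
  change UH.lift (Quint.eps P) (U.lift (UH.quint P).toQuad (U.gen P x))
    = U.lift (Quad.eps P) (U.gen P x)
  cases x <;>
  simp [Quad.val, Quint.val, Quint.eps, UH.quint, Quad.eps]

/-! ### Modules over a bialgebra, as representations `A → End V` -/

section Modules

variable {A : Type*} [Ring A] [Bialgebra ℂ A]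
variable {V W V' W' : Type*} [AddCommGroup V] [Module ℂ V] [AddCommGroup W] [Module ℂ W]
  [AddCommGroup V'] [Module ℂ V'] [AddCommGroup W'] [Module ℂ W']

/-- The tensor product of two modules; the action is through the coproduct. -/
def tensorRep (ρ : A →ₐ[ℂ] Module.End ℂ V) (σ : A →ₐ[ℂ] Module.End ℂ W) :
    A →ₐ[ℂ] Module.End ℂ (V ⊗[ℂ] W) :=
  Module.endTensorEndAlgHom.comp
    ((Algebra.TensorProduct.map ρ σ).comp (Bialgebra.comulAlgHom ℂ A))

variable (A) in
/-- The unit object: `ℂ` with the action through the counit. -/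
def unitRep : A →ₐ[ℂ] Module.End ℂ ℂ :=
  (Algebra.ofId ℂ (Module.End ℂ ℂ)).comp (Bialgebra.counitAlgHom ℂ A)

/-- The vector space of morphisms of modules. -/
def Hom (ρ : A →ₐ[ℂ] Module.End ℂ V) (σ : A →ₐ[ℂ] Module.End ℂ W) :
    Submodule ℂ (V →ₗ[ℂ] W) where
  carrier := {f | ∀ a v, f (ρ a v) = σ a (f v)}
  add_mem' := by
    intro f g hf hg a v
    simp [hf a v, hg a v]
  zero_mem' := by intro a v; simp
  smul_mem' := by
    intro c f hf a v
    simp [hf a v]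

lemma map_mem_hom {ρ : A →ₐ[ℂ] Module.End ℂ V} {σ : A →ₐ[ℂ] Module.End ℂ W}
    {ρ' : A →ₐ[ℂ] Module.End ℂ V'} {σ' : A →ₐ[ℂ] Module.End ℂ W'}
    {f : V →ₗ[ℂ] V'} {g : W →ₗ[ℂ] W'} (hf : f ∈ Hom ρ ρ') (hg : g ∈ Hom σ σ') :
    TensorProduct.map f g ∈ Hom (tensorRep ρ σ) (tensorRep ρ' σ') := by
  intro a x
  have key : ∀ y : A ⊗[ℂ] A,
      TensorProduct.map f g ∘ₗ Module.endTensorEndAlgHom (R := ℂ) (S := ℂ) (A := ℂ)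
          (Algebra.TensorProduct.map ρ σ y)
        = Module.endTensorEndAlgHom (R := ℂ) (S := ℂ) (A := ℂ)
          (Algebra.TensorProduct.map ρ' σ' y) ∘ₗ TensorProduct.map f g := by
    intro y
    induction y with
    | zero => simp
    | add y z hy hz => simp only [map_add, LinearMap.comp_add, LinearMap.add_comp, hy, hz]
    | tmul b c =>
      ext v w
      simp [Module.endTensorEndAlgHom_apply, hf b v, hg c w]
  exact LinearMap.congr_fun (key _) x

/-- Composition with a fixed morphism, as a linear map between spaces of morphisms. -/
def Hom.push (τ : A →ₐ[ℂ] Module.End ℂ V') {ρ : A →ₐ[ℂ] Module.End ℂ V}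
    {σ : A →ₐ[ℂ] Module.End ℂ W} (g : V →ₗ[ℂ] W) (hg : g ∈ Hom ρ σ) :
    Hom τ ρ →ₗ[ℂ] Hom τ σ where
  toFun f := ⟨g ∘ₗ f.1, by
    intro a v
    simp [f.2 a v, hg a (f.1 v)]⟩
  map_add' f f' := by ext; simp
  map_smul' c f := by ext; simp

/-- `V` is nonzero and has no submodules but `0` and `V`. -/
def IsSimpleRep (ρ : A →ₐ[ℂ] Module.End ℂ V) : Prop :=
  Nontrivial V ∧ ∀ N : Submodule ℂ V, (∀ a, ∀ v ∈ N, ρ a v ∈ N) → N = ⊥ ∨ N = ⊤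

end Modules

/-! ### Weight modules over `Ū_q^H(sl₂)` and over `Ū_q(sl₂)` -/

section Weight

variable {P : RootData}
variable {V W V₁ V₂ V₃ W₁ W₂ W₃ : Type*}
  [AddCommGroup V] [Module ℂ V] [AddCommGroup W] [Module ℂ W]
  [AddCommGroup V₁] [Module ℂ V₁] [AddCommGroup V₂] [Module ℂ V₂] [AddCommGroup V₃] [Module ℂ V₃]
  [AddCommGroup W₁] [Module ℂ W₁] [AddCommGroup W₂] [Module ℂ W₂] [AddCommGroup W₃] [Module ℂ W₃]

/-- Weight modules over `Ū_q^H(sl₂)` (the objects of the category `𝒞^H`): finite-dimensional,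
`H` is diagonalizable, and `K = q ^ H`, i.e. `K` acts as `q ^ μ` on the `μ`-eigenspace of `H`. -/
def IsWeightModuleH (ρ : UH P →ₐ[ℂ] Module.End ℂ V) : Prop :=
  FiniteDimensional ℂ V ∧
  (⨆ μ : ℂ, (ρ (UH.gen P GenH.H)).eigenspace μ = ⊤) ∧
  ∀ (μ : ℂ) (v : V), ρ (UH.gen P GenH.H) v = μ • v → ρ (UH.gen P GenH.K) v = P.qpow μ • v

/-- `v` is a highest weight vector of weight `μ` for `Ū_q^H(sl₂)`. -/
def IsHighestWeightVectorH (ρ : UH P →ₐ[ℂ] Module.End ℂ V) (μ : ℂ) (v : V) : Prop :=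
  v ≠ 0 ∧ ρ (UH.gen P GenH.E) v = 0 ∧ ρ (UH.gen P GenH.H) v = μ • v

/-- `(V, ρ)` with the vector `v` is the module `V_i` with a chosen highest weight vector:
the simple weight `Ū_q^H(sl₂)`-module of highest weight `i + r - 1`. -/
def IsModelH (i : ℂ) (ρ : UH P →ₐ[ℂ] Module.End ℂ V) (v : V) : Prop :=
  IsWeightModuleH ρ ∧ IsSimpleRep ρ ∧ IsHighestWeightVectorH ρ (i + P.r - 1) v

/-- Weight modules over `Ū_q(sl₂)` (the objects of the category `𝒞`): finite-dimensional,
and `K` is diagonalizable. -/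
def IsWeightModule (σ : U P →ₐ[ℂ] Module.End ℂ W) : Prop :=
  FiniteDimensional ℂ W ∧ ⨆ c : ℂ, (σ (U.gen P Gen.K)).eigenspace c = ⊤

/-- `w` is a weight vector of weight `μ ∈ ℂ / 2rℤ` that is killed by `E` and generates `W`. -/
def IsGeneratingHighestWeightVector (σ : U P →ₐ[ℂ] Module.End ℂ W) (μ : P.WeightGroup)
    (w : W) : Prop :=
  w ≠ 0 ∧ σ (U.gen P Gen.E) w = 0 ∧ σ (U.gen P Gen.K) w = P.qpowTilde μ • w ∧
    ∀ x : W, ∃ a : U P, σ a w = x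

/-- `(W, σ)` with the vector `w` is the module `V_ĩ` with a chosen highest weight vector, for
`ĩ ∈ ℂ / 2rℤ`: the highest weight `Ū_q(sl₂)`-module of highest weight `ĩ` plus the class of
`r - 1`. -/
def IsModel (i : P.WeightGroup) (σ : U P →ₐ[ℂ] Module.End ℂ W) (w : W) : Prop :=
  IsWeightModule σ ∧ IsGeneratingHighestWeightVector σ (i + P.tilde (P.r - 1)) w

/-- The forgetful functor `φ : 𝒞^H → 𝒞` on objects: forget the action of `H`. -/
def forgetH (ρ : UH P →ₐ[ℂ] Module.End ℂ V) : U P →ₐ[ℂ] Module.End ℂ V := ρ.comp (incl P)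

lemma forgetH_tensorRep (ρ : UH P →ₐ[ℂ] Module.End ℂ V) (σ : UH P →ₐ[ℂ] Module.End ℂ W) :
    forgetH (tensorRep ρ σ) = tensorRep (forgetH ρ) (forgetH σ) := by
  unfold forgetH tensorRep
  rw [AlgHom.comp_assoc, AlgHom.comp_assoc, comul_incl, Algebra.TensorProduct.map_comp,
    AlgHom.comp_assoc]

lemma forgetH_unitRep : forgetH (unitRep (UH P)) = unitRep (U P) := by
  unfold forgetH unitRep
  rw [AlgHom.comp_assoc, counit_incl]

lemma mem_hom_forgetH {ρ : UH P →ₐ[ℂ] Module.End ℂ V} {σ : UH P →ₐ[ℂ] Module.End ℂ W}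
    {f : V →ₗ[ℂ] W} (hf : f ∈ Hom ρ σ) : f ∈ Hom (forgetH ρ) (forgetH σ) :=
  fun a v => hf (incl P a) v

/-- The space `H^{ijk} = Hom_{𝒞^H}(𝕀, V_i ⊗ V_j ⊗ V_k)`. -/
abbrev MultH (ρ₁ : UH P →ₐ[ℂ] Module.End ℂ V₁) (ρ₂ : UH P →ₐ[ℂ] Module.End ℂ V₂)
    (ρ₃ : UH P →ₐ[ℂ] Module.End ℂ V₃) : Submodule ℂ (ℂ →ₗ[ℂ] (V₁ ⊗[ℂ] V₂) ⊗[ℂ] V₃) :=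
  Hom (unitRep (UH P)) (tensorRep (tensorRep ρ₁ ρ₂) ρ₃)

/-- The space `Hom_𝒞(𝕀, W₁ ⊗ W₂ ⊗ W₃)`. -/
abbrev Mult (σ₁ : U P →ₐ[ℂ] Module.End ℂ W₁) (σ₂ : U P →ₐ[ℂ] Module.End ℂ W₂)
    (σ₃ : U P →ₐ[ℂ] Module.End ℂ W₃) : Submodule ℂ (ℂ →ₗ[ℂ] (W₁ ⊗[ℂ] W₂) ⊗[ℂ] W₃) :=
  Hom (unitRep (U P)) (tensorRep (tensorRep σ₁ σ₂) σ₃)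

/-- The linear map
`Hom_{𝒞^H}(𝕀, V₁ ⊗ V₂ ⊗ V₃) → Hom_𝒞(𝕀, φ(V₁) ⊗ φ(V₂) ⊗ φ(V₃))` given by the functor `φ`,
which does not change the underlying linear map of a morphism. -/
def forgetMult (ρ₁ : UH P →ₐ[ℂ] Module.End ℂ V₁) (ρ₂ : UH P →ₐ[ℂ] Module.End ℂ V₂)
    (ρ₃ : UH P →ₐ[ℂ] Module.End ℂ V₃) :
    MultH ρ₁ ρ₂ ρ₃ →ₗ[ℂ] Mult (forgetH ρ₁) (forgetH ρ₂) (forgetH ρ₃) :=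
  Submodule.inclusion (by
    intro f hf
    have h := mem_hom_forgetH hf
    rwa [forgetH_unitRep, forgetH_tensorRep, forgetH_tensorRep] at h)

/-- The morphism `f` of `Ū_q(sl₂)`-modules is an isomorphism and carries `v` to `w`. -/
def IsPointedIso {ρ : U P →ₐ[ℂ] Module.End ℂ V} {σ : U P →ₐ[ℂ] Module.End ℂ W} (v : V) (w : W)
    (f : Hom ρ σ) : Prop :=
  Function.Bijective f.1 ∧ f.1 v = w

/-- The composition
`Hom_{𝒞^H}(𝕀, V₁ ⊗ V₂ ⊗ V₃) → Hom_𝒞(𝕀, φ(V₁) ⊗ φ(V₂) ⊗ φ(V₃)) → Hom_𝒞(𝕀, W₁ ⊗ W₂ ⊗ W₃)` of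
the map given by `φ` and the map induced by morphisms `f₁, f₂, f₃` from `φ(V₁), φ(V₂), φ(V₃)`
to `W₁, W₂, W₃`. -/
def compMult {ρ₁ : UH P →ₐ[ℂ] Module.End ℂ V₁} {ρ₂ : UH P →ₐ[ℂ] Module.End ℂ V₂}
    {ρ₃ : UH P →ₐ[ℂ] Module.End ℂ V₃} {σ₁ : U P →ₐ[ℂ] Module.End ℂ W₁}
    {σ₂ : U P →ₐ[ℂ] Module.End ℂ W₂} {σ₃ : U P →ₐ[ℂ] Module.End ℂ W₃}
    (f₁ : Hom (forgetH ρ₁) σ₁) (f₂ : Hom (forgetH ρ₂) σ₂) (f₃ : Hom (forgetH ρ₃) σ₃) :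
    MultH ρ₁ ρ₂ ρ₃ →ₗ[ℂ] Mult σ₁ σ₂ σ₃ :=
  Hom.push _ (TensorProduct.map (TensorProduct.map f₁.1 f₂.1) f₃.1)
    (map_mem_hom (map_mem_hom f₁.2 f₂.2) f₃.2) ∘ₗ forgetMult ρ₁ ρ₂ ρ₃

end Weight

end QuantumSl2

end

open QuantumSl2

/-! An invariant of `V_i ⊗ V_j ⊗ V_k` is a vector killed by `E` and `F` and fixed by `K`; over
`Ū_q^H(sl₂)` it is also killed by `H`. The proof parametrizes such vectors by weight vectors of the
first factor `V_i`.

For an admissible label the coefficients in `E F^(n+1) v = c_n F^n v` do not vanish for `n + 1 < r`.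
Hence the vectors `F^n v` with `n < r` form a basis, on which the generators of `Ū_q(sl₂)` act by
formulas that depend only on the label (`IsTypical`). Matching these bases gives the pointed
isomorphisms (`existsUnique_isPointedIso`).

The core is linear algebra. If `S` is a single nilpotent Jordan block of size `r` on `V` and `N ^ r
= 0` on `X`, then the kernel of `1 ⊗ S + N ⊗ 1` on `X ⊗ V` is isomorphic to `X`, by the coefficient
at the end of the Jordan chain (`eq_zero_of_mixed_eq_zero`, `exists_mixed_eq_zero`). Up to an
invertible factor, both `Δ F` and `Δ E` have this shape, with `S = F` and `S = K⁻¹ E` respectively.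
So the kernel of `F` on `(V_i ⊗ V_j) ⊗ V_k` is a copy of `V_i ⊗ V_j`, and the kernel of `E` on `V_i
⊗ V_j` is a copy of `V_i`. The composite coefficient map `leading` is injective on invariants and
lands in a fixed eigenspace of `K`; over `Ū_q^H(sl₂)` it lands in the eigenspace of `H` for `-(j +
k)`.

The eigenvalues of `H` on `V_i` are `i + r - 1 - 2n` with `0 ≤ n < r`. Therefore an invariant forces
`i + j + k = 2n - (r - 1)` (`multH_eq_bot`), and conversely `F^n v` lifts back to an invariant
(`exists_multH_ne_zero`). The corresponding eigenvalues of `K` are still pairwise distinct, since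
`q²` has order exactly `r`, so the invariants already form a space of dimension at most one without
`H` (`exists_smul_eq_of_mult`). A nonzero invariant over `Ū_q^H(sl₂)` thus spans the space on either
side, and the injective comparison map is an isomorphism. -/

open scoped TensorProduct

noncomputable section

namespace QuantumSl2

/-! ### The kernel of `1 ⊗ S + N ⊗ 1` -/

section Coefficient

variable {X Y V : Type*} [AddCommGroup X] [Module ℂ X] [AddCommGroup Y] [Module ℂ Y]
  [AddCommGroup V] [Module ℂ V]

/-- Contraction of the second factor of a tensor product with a linear form. -/
def contract (X : Type*) [AddCommGroup X] [Module ℂ X] (φ : V →ₗ[ℂ] ℂ) : X ⊗[ℂ] V →ₗ[ℂ] X :=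
  (TensorProduct.rid ℂ X).toLinearMap ∘ₗ TensorProduct.map LinearMap.id φ

@[simp] lemma contract_tmul (φ : V →ₗ[ℂ] ℂ) (x : X) (v : V) :
    contract X φ (x ⊗ₜ v) = φ v • x := by
  simp [contract]

lemma contract_map (φ : V →ₗ[ℂ] ℂ) (N : X →ₗ[ℂ] X) (S : V →ₗ[ℂ] V) (y : X ⊗[ℂ] V) :
    contract X φ (TensorProduct.map N S y) = N (contract X (φ ∘ₗ S) y) := by
  induction y with
  | zero => simp
  | add y z hy hz => simp only [map_add, hy, hz]
  | tmul x v => simp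

lemma contract_smul (c : ℂ) (φ : V →ₗ[ℂ] ℂ) (y : X ⊗[ℂ] V) :
    contract X (c • φ) y = c • contract X φ y := by
  induction y with
  | zero => simp
  | add y z hy hz => simp only [map_add, hy, hz, smul_add]
  | tmul x v => simp [mul_smul]

lemma contract_zero (y : X ⊗[ℂ] V) : contract X (0 : V →ₗ[ℂ] ℂ) y = 0 := by
  simpa using contract_smul 0 (0 : V →ₗ[ℂ] ℂ) y

lemma eq_zero_of_contract_coord {ι : Type*} [Fintype ι] (b : Module.Basis ι ℂ V) (y : X ⊗[ℂ] V)
    (h : ∀ a, contract X (b.coord a) y = 0) : y = 0 := by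
  have key : ∀ y : X ⊗[ℂ] V, ∑ a, contract X (b.coord a) y ⊗ₜ[ℂ] b a = y := by
    intro y
    induction y with
    | zero => simp
    | add y z hy hz =>
      simp only [map_add, TensorProduct.add_tmul, Finset.sum_add_distrib, hy, hz]
    | tmul x v =>
      simp only [contract_tmul, TensorProduct.smul_tmul, ← TensorProduct.tmul_sum]
      congr 1
      exact b.sum_repr v
  rw [← key y]
  simp [h]

lemma coord_comp_of_eigen {ι : Type*} (b : Module.Basis ι ℂ V) {t : V →ₗ[ℂ] V} {κ : ι → ℂ}
    (h : ∀ a, t (b a) = κ a • b a) (a : ι) : b.coord a ∘ₗ t = κ a • b.coord a := by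
  classical
  refine b.ext fun c => ?_
  by_cases hc : c = a
  · subst hc; simp [h]
  · simp [h, hc]

/-- `1 ⊗ S + N ⊗ 1`. -/
def mixed (N : X →ₗ[ℂ] X) (S : V →ₗ[ℂ] V) : X ⊗[ℂ] V →ₗ[ℂ] X ⊗[ℂ] V :=
  TensorProduct.map LinearMap.id S + TensorProduct.map N LinearMap.id

variable {r : ℕ} {N : Module.End ℂ X} {S : Module.End ℂ V} {u : V} (b : Module.Basis (Fin r) ℂ V)
  (hb : ∀ a, b a = (S ^ (a : ℕ)) u)

include hb in
-- Write `y = ∑ c_a ⊗ S^a u`. The equation says `c_a = -N c_(a+1)`, so the last coefficient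
-- `c_(r-1)` determines all the others.
lemma eq_zero_of_mixed_eq_zero (hr : 0 < r) (hS : S ^ r = 0) {y : X ⊗[ℂ] V}
    (hy : mixed N S y = 0) (htop : contract X (b.coord ⟨r - 1, by omega⟩) y = 0) : y = 0 := by
  -- On the dual basis the shift `S` runs backwards; `S ^ r = 0` takes care of the last basis
  -- vector.
  have hstep : ∀ a (ha : a + 1 < r),
      b.coord ⟨a + 1, ha⟩ ∘ₗ S = b.coord ⟨a, by omega⟩ := by
    intro a ha
    refine b.ext fun c => ?_
    have hSc : S (b c) = (S ^ ((c : ℕ) + 1)) u := by rw [hb, pow_succ']; rfl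
    rw [LinearMap.comp_apply, hSc]
    by_cases hc : (c : ℕ) + 1 < r
    · have := hb ⟨(c : ℕ) + 1, hc⟩
      simp only at this
      rw [← this]
      simp [Finsupp.single_apply, Fin.ext_iff]
    · have : (c : ℕ) + 1 = r := by omega
      rw [this, hS]
      have : c ≠ ⟨a, by omega⟩ := by
        intro h; simp only [Fin.ext_iff] at h; omega
      simp [this]
  -- Descending induction along the chain, with `d` the distance from the last coefficient.
  have key : ∀ d (hd : d < r), contract X (b.coord ⟨r - 1 - d, by omega⟩) y = 0 := by
    intro d
    induction d with
    | zero => intro _; exact htop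
    | succ d ih =>
      intro hd
      have h1 := congrArg (contract X (b.coord ⟨r - 1 - (d + 1) + 1, by omega⟩)) hy
      rw [mixed, LinearMap.add_apply, map_add, contract_map, contract_map, hstep] at h1
      have h2 := ih (by omega)
      have e : r - 1 - d = r - 1 - (d + 1) + 1 := by omega
      simp only [e] at h2
      simpa [h2] using h1
  refine eq_zero_of_contract_coord b y fun a => ?_
  have h := key (r - 1 - a) (by omega)
  have e : r - 1 - (r - 1 - (a : ℕ)) = a := by omega
  simpa only [e] using h

include hb in
-- Solving the recursion `c_a = -N c_(a+1)` from `c_(r-1) = x` gives a vector whose image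
-- telescopes. The two boundary terms vanish because `S ^ r = 0` and `N ^ r = 0`.
lemma exists_mixed_eq_zero (hr : 0 < r) (hS : S ^ r = 0) (hN : N ^ r = 0) (x : X) :
    ∃ y : X ⊗[ℂ] V, mixed N S y = 0 ∧ contract X (b.coord ⟨r - 1, by omega⟩) y = x := by
  refine ⟨∑ a ∈ Finset.range r, (((-N) ^ (r - (a + 1))) x) ⊗ₜ[ℂ] ((S ^ a) u), ?_, ?_⟩
  · have h : ∀ a ∈ Finset.range r,
        mixed N S ((((-N) ^ (r - (a + 1))) x) ⊗ₜ[ℂ] ((S ^ a) u))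
          = (((-N) ^ (r - (a + 1))) x) ⊗ₜ[ℂ] ((S ^ (a + 1)) u)
            - (((-N) ^ (r - a)) x) ⊗ₜ[ℂ] ((S ^ a) u) := by
      intro a ha
      have e : r - a = r - (a + 1) + 1 := by
        have := Finset.mem_range.mp ha; omega
      rw [e, pow_succ' (-N), pow_succ' S]
      simp [mixed, TensorProduct.neg_tmul]
    rw [map_sum, Finset.sum_congr rfl h,
      Finset.sum_range_sub (fun a => (((-N) ^ (r - a)) x) ⊗ₜ[ℂ] ((S ^ a) u))]
    simp [hS, neg_pow N, hN]
  · rw [map_sum, Finset.sum_eq_single (r - 1)]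
    · have := hb ⟨r - 1, by omega⟩
      simp only at this
      rw [contract_tmul, ← this]
      have e : r - (r - 1 + 1) = 0 := by omega
      simp [e]
    · intro a ha hne
      have ha' := Finset.mem_range.mp ha
      have := hb ⟨a, ha'⟩
      simp only at this
      rw [contract_tmul, ← this]
      simp [Fin.ext_iff, hne]
    · intro h
      exact absurd (Finset.mem_range.mpr (by omega)) h

end Coefficient

/-! ### Bases of iterates -/

section Iterates

variable {V : Type*} [AddCommGroup V] [Module ℂ V] {r : ℕ} {p κ : ℂ} {K S : Module.End ℂ V} {u : V}

lemma apply_pow_of_commute (hKS : K * S = p • (S * K)) (hu : K u = κ • u) (n : ℕ) :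
    K ((S ^ n) u) = (p ^ n * κ) • (S ^ n) u := by
  have h := LinearMap.congr_fun (pow_mul_comm_q hKS n) u
  simpa [hu, smul_smul] using h

lemma linearIndependent_pow (hp : IsPrimitiveRoot p r) (hKS : K * S = p • (S * K))
    (hu : K u = κ • u) (hκ : κ ≠ 0) (hne : ∀ n < r, (S ^ n) u ≠ 0) :
    LinearIndependent ℂ (fun a : Fin r => (S ^ (a : ℕ)) u) := by
  -- The eigenvalues `p ^ a * κ` with `a < r` are distinct because `p` has order exactly `r`.
  refine Module.End.eigenvectors_linearIndependent' K (fun a : Fin r => p ^ (a : ℕ) * κ) ?_ _ ?_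
  · intro a c h
    exact Fin.ext (hp.pow_inj a.2 c.2 (mul_right_cancel₀ hκ h))
  · intro a
    exact ⟨Module.End.mem_eigenspace_iff.mpr (apply_pow_of_commute hKS hu a), hne a a.2⟩

end Iterates

/-! ### The root of unity -/

namespace RootData

variable (P : RootData)

lemma r_pos : 0 < P.r := by have := P.one_lt; omega

lemma qpow_ne_zero (x : ℂ) : P.qpow x ≠ 0 := Complex.exp_ne_zero _

lemma qpow_add (x y : ℂ) : P.qpow (x + y) = P.qpow x * P.qpow y := by
  rw [qpow, qpow, qpow, ← Complex.exp_add]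
  congr 1
  ring

lemma qpow_neg (x : ℂ) : P.qpow (-x) = (P.qpow x)⁻¹ := by
  rw [qpow, qpow, ← Complex.exp_neg]
  congr 1
  ring

lemma qpow_natCast (n : ℕ) : P.qpow n = P.q ^ n := by
  rw [q, qpow, qpow, ← Complex.exp_nat_mul]
  congr 1
  ring

lemma q_sub_inv_ne_zero : P.q - P.q⁻¹ ≠ 0 := by
  intro h
  have h1 : P.q ^ 2 = 1 := by
    rw [sq]
    nth_rewrite 1 [sub_eq_zero.mp h]
    exact inv_mul_cancel₀ P.q_ne_zero
  exact P.isPrimitiveRoot_q_sq.ne_one P.one_lt h1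

/-- This is where admissibility enters. Equality would make `m (i + n)` a multiple of `r`, so `m i`
would be an integer, hence divisible by `r`; then `r` divides `n m`, and so `n`, which is impossible
for `0 < n < r`. -/
lemma qpow_sq_ne_one {i : ℂ} (hi : P.Label i) {n : ℤ} (h0 : 0 < n) (hn : n < P.r) :
    P.qpow (i + n) ^ 2 ≠ 1 := by
  intro h
  rw [qpow, ← Complex.exp_nat_mul, Complex.exp_eq_one_iff] at h
  obtain ⟨l, hl⟩ := h
  have hr := P.r_ne_zero
  have h1 : (i + n) * P.m = l * P.r := by
    have h2 : (i + n) * P.m * (2 * Real.pi * Complex.I)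
        = l * P.r * (2 * Real.pi * Complex.I) := by
      field_simp at hl
      push_cast at hl
      linear_combination (Real.pi * Complex.I) * hl
    exact mul_right_cancel₀ Complex.two_pi_I_ne_zero h2
  have h3 : (P.r : ℤ) ∣ l * P.r - n * P.m := by
    apply hi.2
    push_cast
    linear_combination h1
  have h4 : (P.r : ℤ) ∣ n * P.m := (dvd_sub_right (dvd_mul_left _ _)).mp h3
  have h5 : (P.r : ℤ) ∣ n := P.coprime.symm.dvd_of_dvd_mul_right h4
  exact absurd (Int.le_of_dvd h0 h5) (by omega)

/-- The factor in `E F ^ (n + 1) v = liftCoef a n • F ^ n v` for a highest weight vector `v` with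
`K v = a • v`. -/
def liftCoef (a : ℂ) (n : ℕ) : ℂ :=
  (P.q ^ (n + 1) - (P.q ^ (n + 1))⁻¹) * (a * (P.q ^ n)⁻¹ - a⁻¹ * P.q ^ n) / (P.q - P.q⁻¹) ^ 2

lemma liftCoef_zero (a : ℂ) : P.liftCoef a 0 = (P.q - P.q⁻¹)⁻¹ * (a - a⁻¹) := by
  have h := P.q_sub_inv_ne_zero
  simp only [liftCoef, zero_add, pow_one, pow_zero, inv_one, mul_one]
  field_simp

lemma liftCoef_succ {a : ℂ} (ha : a ≠ 0) (n : ℕ) :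
    P.liftCoef a (n + 1) = P.liftCoef a n
      + (P.q - P.q⁻¹)⁻¹ * (((P.q ^ 2)⁻¹ ^ (n + 1) * a) - ((P.q ^ 2)⁻¹ ^ (n + 1) * a)⁻¹) := by
  have h := P.q_sub_inv_ne_zero
  have hq := P.q_ne_zero
  have hx : P.q ^ n ≠ 0 := pow_ne_zero _ hq
  have e : (P.q ^ 2)⁻¹ ^ (n + 1) = (P.q ^ n * P.q)⁻¹ ^ 2 := by
    rw [inv_pow, inv_pow, ← pow_succ, ← pow_mul, ← pow_mul, mul_comm]
  have e2 : (P.q - P.q⁻¹)⁻¹ = (P.q - P.q⁻¹) / (P.q - P.q⁻¹) ^ 2 := by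
    field_simp
  rw [e, e2, liftCoef, liftCoef, div_mul_eq_mul_div, ← add_div]
  congr 1
  simp only [pow_succ]
  generalize P.q ^ n = x at *
  generalize P.q = q at *
  field_simp
  ring

/-- The first factor of the numerator vanishes only if `q^(2(n+1)) = 1`, the second only if `q^(2(i
+ r - 1 - n)) = 1`. Both are excluded for `n + 1 < r`. -/
lemma liftCoef_ne_zero {i : ℂ} (hi : P.Label i) {n : ℕ} (hn : n + 1 < P.r) :
    P.liftCoef (P.qpow (i + P.r - 1)) n ≠ 0 := by
  have hq := P.q_ne_zero
  refine div_ne_zero (mul_ne_zero ?_ ?_) (pow_ne_zero 2 P.q_sub_inv_ne_zero)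
  · intro h
    refine P.isPrimitiveRoot_q_sq.pow_ne_one_of_pos_of_lt (Nat.succ_ne_zero n) hn ?_
    have hx : P.q ^ (n + 1) ≠ 0 := pow_ne_zero _ hq
    rw [← pow_mul, mul_comm, pow_mul, sq]
    nth_rewrite 1 [sub_eq_zero.mp h]
    exact inv_mul_cancel₀ hx
  · intro h
    have h1 := P.qpow_sq_ne_one hi (n := P.r - 1 - n) (by omega) (by omega)
    have e : i + (((P.r : ℤ) - 1 - n : ℤ) : ℂ) = (i + P.r - 1) + -(n : ℂ) := by push_cast; ring
    rw [e, P.qpow_add, P.qpow_neg, P.qpow_natCast] at h1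
    have hx : P.q ^ n ≠ 0 := pow_ne_zero _ hq
    have ha := P.qpow_ne_zero (i + P.r - 1)
    generalize P.q ^ n = x at *
    generalize P.qpow (i + P.r - 1) = a at *
    apply h1
    have h2 := sub_eq_zero.mp h
    rw [sq]
    nth_rewrite 1 [h2]
    field_simp

end RootData

/-! ### Actions of generators -/

lemma U.induction {P : RootData} {p : U P → Prop} (hgen : ∀ g, p (U.gen P g))
    (hscalar : ∀ c : ℂ, p (algebraMap ℂ (U P) c)) (hadd : ∀ a b, p a → p b → p (a + b))
    (hmul : ∀ a b, p a → p b → p (a * b)) (a : U P) : p a := by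
  obtain ⟨x, rfl⟩ := RingQuot.mkAlgHom_surjective ℂ (Rel P) a
  induction x using FreeAlgebra.induction with
  | grade0 c =>
    rw [AlgHom.commutes (RingQuot.mkAlgHom ℂ (Rel P)) c]
    exact hscalar c
  | grade1 g => exact hgen g
  | add x y hx hy =>
    rw [map_add]
    exact hadd _ _ hx hy
  | mul x y hx hy =>
    rw [map_mul]
    exact hmul _ _ hx hy

lemma UH.induction {P : RootData} {p : UH P → Prop} (hgen : ∀ g, p (UH.gen P g))
    (hscalar : ∀ c : ℂ, p (algebraMap ℂ (UH P) c)) (hadd : ∀ a b, p a → p b → p (a + b))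
    (hmul : ∀ a b, p a → p b → p (a * b)) (a : UH P) : p a := by
  obtain ⟨x, rfl⟩ := RingQuot.mkAlgHom_surjective ℂ (RelH P) a
  induction x using FreeAlgebra.induction with
  | grade0 c =>
    rw [AlgHom.commutes (RingQuot.mkAlgHom ℂ (RelH P)) c]
    exact hscalar c
  | grade1 g => exact hgen g
  | add x y hx hy =>
    rw [map_add]
    exact hadd _ _ hx hy
  | mul x y hx hy =>
    rw [map_mul]
    exact hmul _ _ hx hy

/-- The image of a quadruple under a homomorphism of algebras. -/
def Quad.map {P : RootData} {R S : Type*} [Ring R] [Algebra ℂ R] [Ring S] [Algebra ℂ S]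
    (s : Quad P R) (f : R →ₐ[ℂ] S) : Quad P S where
  E := f s.E
  F := f s.F
  K := f s.K
  Ki := f s.Ki
  K_Ki := by rw [← map_mul, s.K_Ki, map_one]
  Ki_K := by rw [← map_mul, s.Ki_K, map_one]
  K_E := by rw [← map_mul, ← map_mul, s.K_E, map_smul]
  K_F := by rw [← map_mul, ← map_mul, s.K_F, map_smul]
  E_F := by rw [← map_mul, ← map_mul, ← map_sub, s.E_F, map_smul, map_sub]
  E_pow := by rw [← map_pow, s.E_pow, map_zero]
  F_pow := by rw [← map_pow, s.F_pow, map_zero]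

/-- The operators by which the generators act. -/
abbrev ops {P : RootData} {V : Type*} [AddCommGroup V] [Module ℂ V]
    (σ : U P →ₐ[ℂ] Module.End ℂ V) : Quad P (Module.End ℂ V) := (U.quad P).map σ

section Ops

variable {P : RootData} {V W : Type*} [AddCommGroup V] [Module ℂ V] [AddCommGroup W] [Module ℂ W]
  (σ : U P →ₐ[ℂ] Module.End ℂ V) (τ : U P →ₐ[ℂ] Module.End ℂ W)
  (ρ : UH P →ₐ[ℂ] Module.End ℂ V) (π : UH P →ₐ[ℂ] Module.End ℂ W)

lemma ops_val (g : Gen) : (ops σ).val g = σ (U.gen P g) := by cases g <;> rfl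

lemma comul_gen (g : Gen) :
    Bialgebra.comulAlgHom ℂ (U P) (U.gen P g) = (U.quad P).delta.val g :=
  U.lift_gen _ g

lemma counit_gen (g : Gen) :
    Bialgebra.counitAlgHom ℂ (U P) (U.gen P g) = (Quad.eps P).val g :=
  U.lift_gen _ g

lemma comulH_gen (g : GenH) :
    Bialgebra.comulAlgHom ℂ (UH P) (UH.gen P g) = (UH.quint P).delta.val g :=
  UH.lift_gen _ g

lemma counitH_gen (g : GenH) :
    Bialgebra.counitAlgHom ℂ (UH P) (UH.gen P g) = (Quint.eps P).val g :=
  UH.lift_gen _ g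

lemma ops_tensorRep_E : (ops (tensorRep σ τ)).E
    = TensorProduct.map LinearMap.id (ops τ).E + TensorProduct.map (ops σ).E (ops τ).K := by
  change tensorRep σ τ (U.gen P Gen.E) = _
  rw [tensorRep, AlgHom.comp_apply, AlgHom.comp_apply, comul_gen]
  ext v w
  simp [Quad.val, Quad.delta, Module.endTensorEndAlgHom_apply, Quad.map]

lemma ops_tensorRep_F : (ops (tensorRep σ τ)).F
    = TensorProduct.map (ops σ).Ki (ops τ).F + TensorProduct.map (ops σ).F LinearMap.id := by
  change tensorRep σ τ (U.gen P Gen.F) = _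
  rw [tensorRep, AlgHom.comp_apply, AlgHom.comp_apply, comul_gen]
  ext v w
  simp [Quad.val, Quad.delta, Module.endTensorEndAlgHom_apply, Quad.map]

lemma ops_tensorRep_K :
    (ops (tensorRep σ τ)).K = TensorProduct.map (ops σ).K (ops τ).K := by
  change tensorRep σ τ (U.gen P Gen.K) = _
  rw [tensorRep, AlgHom.comp_apply, AlgHom.comp_apply, comul_gen]
  ext v w
  simp [Quad.val, Quad.delta, Module.endTensorEndAlgHom_apply, Quad.map]

/-- The action of `H`. -/
abbrev opH : Module.End ℂ V := ρ (UH.gen P GenH.H)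

lemma opH_tensorRep : opH (tensorRep ρ π)
    = TensorProduct.map (opH ρ) LinearMap.id + TensorProduct.map LinearMap.id (opH π) := by
  rw [opH, tensorRep, AlgHom.comp_apply, AlgHom.comp_apply, comulH_gen]
  ext v w
  simp [Quint.val, Quint.delta, Module.endTensorEndAlgHom_apply, UH.quint]

lemma forgetH_gen (g : Gen) : forgetH ρ (U.gen P g) = ρ ((UH.quint P).toQuad.val g) := by
  rw [forgetH, AlgHom.comp_apply, incl, U.lift_gen]

lemma opH_mul_E : opH ρ * (ops (forgetH ρ)).E
    = (ops (forgetH ρ)).E * opH ρ + (2 : ℂ) • (ops (forgetH ρ)).E := by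
  have e : (ops (forgetH ρ)).E = ρ (UH.quint P).E := forgetH_gen ρ Gen.E
  rw [e, opH, ← map_mul, ← map_mul, ← map_smul, ← map_add]
  congr 1
  rw [← (UH.quint P).H_E]
  exact (add_sub_cancel _ _).symm

lemma opH_mul_F : opH ρ * (ops (forgetH ρ)).F
    = (ops (forgetH ρ)).F * opH ρ + -(2 : ℂ) • (ops (forgetH ρ)).F := by
  have e : (ops (forgetH ρ)).F = ρ (UH.quint P).F := forgetH_gen ρ Gen.F
  rw [e, opH, ← map_mul, ← map_mul, ← map_smul, ← map_add]
  congr 1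
  rw [← (UH.quint P).H_F]
  exact (add_sub_cancel _ _).symm

end Ops

/-! ### Typical modules -/

/-- Supplies the nilpotency of `K F` and `K⁻¹ E` that the kernel computation needs: moving all `Y`
to the right turns `(Y X) ^ n` into a multiple of `X ^ n * Y ^ n`. -/
lemma mul_pow_eq_zero {R : Type*} [Ring R] [Algebra ℂ R] {p : ℂ} {X Y : R}
    (h : Y * X = p • (X * Y)) {n : ℕ} (hX : X ^ n = 0) : (Y * X) ^ n = 0 := by
  have key : ∀ n : ℕ, ∃ c : ℂ, (Y * X) ^ n = c • (X ^ n * Y ^ n) := by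
    intro n
    induction n with
    | zero => exact ⟨1, by simp⟩
    | succ n ih =>
      obtain ⟨c, hc⟩ := ih
      refine ⟨c * p ^ (n + 1), ?_⟩
      rw [pow_succ', hc, mul_smul_comm, mul_assoc, ← mul_assoc X, ← pow_succ', ← mul_assoc,
        pow_mul_comm_q h, smul_mul_assoc, smul_smul, mul_assoc, ← pow_succ']
  obtain ⟨c, hc⟩ := key n
  rw [hc, hX, zero_mul, smul_zero]

/-- The vector `v` is a highest weight vector of weight `i + r - 1`, for an admissible label `i`,
and the vectors `F ^ n v` with `n < r` span the module. -/
structure IsTypical {P : RootData} {V : Type*} [AddCommGroup V] [Module ℂ V]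
    (s : Quad P (Module.End ℂ V)) (i : ℂ) (v : V) : Prop where
  label : P.Label i
  ne_zero : v ≠ 0
  E_apply : s.E v = 0
  K_apply : s.K v = P.qpow (i + P.r - 1) • v
  span : ⊤ ≤ Submodule.span ℂ (Set.range fun a : Fin P.r => (s.F ^ (a : ℕ)) v)

/-! ### The action of the generators on the vectors `F ^ n v` -/

section HighestWeight

variable {P : RootData} {V : Type*} [AddCommGroup V] [Module ℂ V]
  {s : Quad P (Module.End ℂ V)} {v : V} {a : ℂ}

lemma Quad.Ki_apply_of_eigen (s : Quad P (Module.End ℂ V)) {c : ℂ} {x : V} (hc : c ≠ 0)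
    (h : s.K x = c • x) : s.Ki x = c⁻¹ • x := by
  have h1 : s.Ki (s.K x) = x := LinearMap.congr_fun s.Ki_K x
  rw [h, map_smul] at h1
  nth_rewrite 2 [← h1]
  rw [smul_smul, inv_mul_cancel₀ hc, one_smul]

lemma Quad.K_F_pow_apply (hK : s.K v = a • v) (n : ℕ) :
    s.K ((s.F ^ n) v) = ((P.q ^ 2)⁻¹ ^ n * a) • (s.F ^ n) v :=
  apply_pow_of_commute s.KF hK n

lemma Quad.Ki_F_pow_apply (ha : a ≠ 0) (hK : s.K v = a • v) (n : ℕ) :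
    s.Ki ((s.F ^ n) v) = ((P.q ^ 2)⁻¹ ^ n * a)⁻¹ • (s.F ^ n) v :=
  s.Ki_apply_of_eigen
    (mul_ne_zero (pow_ne_zero _ (inv_ne_zero (pow_ne_zero 2 P.q_ne_zero))) ha)
    (Quad.K_F_pow_apply hK n)

/-- Each passage of `E` across one `F` adds the scalar by which `[E, F]` acts on the weight vector
reached; `liftCoef` is the closed form of the resulting sum. -/
lemma Quad.E_F_pow_apply (ha : a ≠ 0) (hE : s.E v = 0) (hK : s.K v = a • v) (n : ℕ) :
    s.E ((s.F ^ (n + 1)) v) = P.liftCoef a n • (s.F ^ n) v := by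
  have h1 : ∀ x, s.E (s.F x) = s.F (s.E x) + (P.q - P.q⁻¹)⁻¹ • (s.K x - s.Ki x) := by
    intro x
    have h := LinearMap.congr_fun s.E_F x
    simp only [LinearMap.sub_apply, Module.End.mul_apply, LinearMap.smul_apply] at h
    rw [← h]
    abel
  induction n with
  | zero =>
    rw [zero_add, pow_one, h1, hE, hK, s.Ki_apply_of_eigen ha hK, P.liftCoef_zero, ← sub_smul,
      smul_smul]
    simp
  | succ n ih =>
    rw [pow_succ', Module.End.mul_apply, h1, ih, Quad.K_F_pow_apply hK,
      Quad.Ki_F_pow_apply ha hK, P.liftCoef_succ ha, ← sub_smul, smul_smul, map_smul,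
      ← Module.End.mul_apply, ← pow_succ', ← add_smul]

/-- The submodule generated by a highest weight vector is spanned by the `F ^ n v`. -/
lemma Quad.span_stable (ha : a ≠ 0) (hE : s.E v = 0) (hK : s.K v = a • v) (g : Gen)
    {x : V} (hx : x ∈ Submodule.span ℂ (Set.range fun c : Fin P.r => (s.F ^ (c : ℕ)) v)) :
    s.val g x ∈ Submodule.span ℂ (Set.range fun c : Fin P.r => (s.F ^ (c : ℕ)) v) := by
  have hmem : ∀ n, (s.F ^ n) v ∈
      Submodule.span ℂ (Set.range fun c : Fin P.r => (s.F ^ (c : ℕ)) v) := by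
    intro n
    by_cases hn : n < P.r
    · exact Submodule.subset_span ⟨⟨n, hn⟩, rfl⟩
    · rw [pow_eq_zero_of_le (not_lt.mp hn) s.F_pow]
      exact Submodule.zero_mem _
  induction hx using Submodule.span_induction with
  | zero => rw [map_zero]; exact Submodule.zero_mem _
  | add x y _ _ hx hy => rw [map_add]; exact Submodule.add_mem _ hx hy
  | smul c x _ hx => rw [map_smul]; exact Submodule.smul_mem _ c hx
  | mem x hx =>
    obtain ⟨c, rfl⟩ := hx
    obtain ⟨n, hn⟩ := c
    cases g with
    | E =>
      change s.E ((s.F ^ n) v) ∈ _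
      cases n with
      | zero => rw [pow_zero, Module.End.one_apply, hE]; exact Submodule.zero_mem _
      | succ n => rw [Quad.E_F_pow_apply ha hE hK]; exact Submodule.smul_mem _ _ (hmem n)
    | F =>
      change s.F ((s.F ^ n) v) ∈ _
      rw [← Module.End.mul_apply, ← pow_succ']
      exact hmem _
    | K =>
      change s.K ((s.F ^ n) v) ∈ _
      rw [Quad.K_F_pow_apply hK]
      exact Submodule.smul_mem _ _ (hmem n)
    | Ki =>
      change s.Ki ((s.F ^ n) v) ∈ _
      rw [Quad.Ki_F_pow_apply ha hK]
      exact Submodule.smul_mem _ _ (hmem n)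

end HighestWeight

/-! ### Bases and weight spaces of a typical module -/

namespace IsTypical

variable {P : RootData} {V : Type*} [AddCommGroup V] [Module ℂ V]
  {s : Quad P (Module.End ℂ V)} {i : ℂ} {v : V} (h : IsTypical s i v)

include h

lemma K_F_pow (n : ℕ) :
    s.K ((s.F ^ n) v) = ((P.q ^ 2)⁻¹ ^ n * P.qpow (i + P.r - 1)) • (s.F ^ n) v :=
  Quad.K_F_pow_apply h.K_apply n

lemma Ki_F_pow (n : ℕ) :
    s.Ki ((s.F ^ n) v) = ((P.q ^ 2)⁻¹ ^ n * P.qpow (i + P.r - 1))⁻¹ • (s.F ^ n) v :=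
  Quad.Ki_F_pow_apply (P.qpow_ne_zero _) h.K_apply n

lemma E_F_pow (n : ℕ) :
    s.E ((s.F ^ (n + 1)) v) = P.liftCoef (P.qpow (i + P.r - 1)) n • (s.F ^ n) v :=
  Quad.E_F_pow_apply (P.qpow_ne_zero _) h.E_apply h.K_apply n

lemma F_pow_ne_zero : ∀ n < P.r, (s.F ^ n) v ≠ 0
  | 0, _ => by simpa using h.ne_zero
  | n + 1, hn => by
    intro h0
    have h1 := h.E_F_pow n
    rw [h0, map_zero] at h1
    exact smul_ne_zero (P.liftCoef_ne_zero h.label hn) (F_pow_ne_zero n (by omega)) h1.symm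

/-- The basis of the vectors `F ^ n v`. -/
def basis : Module.Basis (Fin P.r) ℂ V :=
  Module.Basis.mk (linearIndependent_pow P.isPrimitiveRoot_q_sq.inv s.KF h.K_apply
    (P.qpow_ne_zero _) h.F_pow_ne_zero) h.span

lemma basis_apply (a : Fin P.r) : h.basis a = (s.F ^ (a : ℕ)) v := by
  simp [basis]

/-- Starting from the lowest weight vector, `K⁻¹ E` climbs back through all weights without
vanishing. Hence it is also a single Jordan block, whose chain ends at a multiple of `v`. -/
lemma exists_step_pow (n : ℕ) (hn : n < P.r) : ∃ c : ℂ, c ≠ 0 ∧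
    ((s.Ki * s.E) ^ n) ((s.F ^ (P.r - 1)) v) = c • (s.F ^ (P.r - 1 - n)) v := by
  induction n with
  | zero => exact ⟨1, one_ne_zero, by simp⟩
  | succ n ih =>
    obtain ⟨c, hc, hS⟩ := ih (by omega)
    have e : P.r - 1 - n = P.r - 1 - (n + 1) + 1 := by omega
    rw [pow_succ', Module.End.mul_apply, hS, e, map_smul, Module.End.mul_apply, h.E_F_pow,
      map_smul, h.Ki_F_pow, smul_smul, smul_smul]
    refine ⟨_, ?_, rfl⟩
    refine mul_ne_zero (mul_ne_zero hc (P.liftCoef_ne_zero h.label (by omega))) (inv_ne_zero ?_)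
    exact mul_ne_zero (pow_ne_zero _ (inv_ne_zero (pow_ne_zero 2 P.q_ne_zero))) (P.qpow_ne_zero _)

omit h in
lemma _root_.QuantumSl2.Quad.K_mul_step (s : Quad P (Module.End ℂ V)) :
    s.K * (s.Ki * s.E) = P.q ^ 2 • ((s.Ki * s.E) * s.K) := by
  rw [mul_assoc s.Ki, ← mul_smul_comm, ← s.KE, ← mul_assoc, ← mul_assoc, s.K_Ki, s.Ki_K]

/-- The basis of the vectors `(K⁻¹ E) ^ n u`, where `u` is the lowest weight vector
`F ^ (r - 1) v`. -/
def lowestBasis : Module.Basis (Fin P.r) ℂ V :=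
  haveI : Nonempty (Fin P.r) := ⟨⟨0, P.r_pos⟩⟩
  basisOfLinearIndependentOfCardEqFinrank
    (linearIndependent_pow P.isPrimitiveRoot_q_sq s.K_mul_step (h.K_F_pow (P.r - 1))
      (mul_ne_zero (pow_ne_zero _ (inv_ne_zero (pow_ne_zero 2 P.q_ne_zero))) (P.qpow_ne_zero _))
      (by
        intro n hn
        obtain ⟨c, hc, hS⟩ := h.exists_step_pow n hn
        rw [hS]
        exact smul_ne_zero hc (h.F_pow_ne_zero _ (by omega))))
    (Module.finrank_eq_card_basis h.basis).symm

lemma lowestBasis_apply (a : Fin P.r) :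
    h.lowestBasis a = ((s.Ki * s.E) ^ (a : ℕ)) ((s.F ^ (P.r - 1)) v) := by
  simp [lowestBasis]

/-- The coefficient of the lowest weight vector. -/
def lowestCoord : V →ₗ[ℂ] ℂ := h.basis.coord ⟨P.r - 1, by have := P.r_pos; omega⟩

/-- The coefficient of the highest weight vector. -/
def highestCoord : V →ₗ[ℂ] ℂ := h.lowestBasis.coord ⟨P.r - 1, by have := P.r_pos; omega⟩

lemma lowestCoord_comp {t : V →ₗ[ℂ] V} {κ : ℕ → ℂ}
    (ht : ∀ n, t ((s.F ^ n) v) = κ n • (s.F ^ n) v) :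
    h.lowestCoord ∘ₗ t = κ (P.r - 1) • h.lowestCoord :=
  coord_comp_of_eigen h.basis (κ := fun a => κ a)
    (fun a => by rw [h.basis_apply, ht]) ⟨P.r - 1, _⟩

lemma highestCoord_comp {t : V →ₗ[ℂ] V} {κ : ℕ → ℂ}
    (ht : ∀ n, t ((s.F ^ n) v) = κ n • (s.F ^ n) v) :
    h.highestCoord ∘ₗ t = κ 0 • h.highestCoord := by
  -- The order of weights is reversed: the `a`-th vector of this basis is a multiple of `F ^ (r - 1
  -- - a) v`.
  have h1 := coord_comp_of_eigen h.lowestBasis (t := t) (κ := fun a => κ (P.r - 1 - a))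
    (fun a => by
      obtain ⟨c, -, hS⟩ := h.exists_step_pow a a.2
      rw [h.lowestBasis_apply, hS, map_smul, ht, smul_comm])
    ⟨P.r - 1, by have := P.r_pos; omega⟩
  simpa [highestCoord] using h1

lemma lowestCoord_comp_E : h.lowestCoord ∘ₗ s.E = 0 := by
  refine h.basis.ext fun a => ?_
  obtain ⟨n, hn⟩ := a
  rw [LinearMap.comp_apply, h.basis_apply]
  cases n with
  | zero => simp [h.E_apply]
  | succ n =>
    have h1 := h.basis_apply ⟨n, by omega⟩
    simp only at h1 ⊢
    rw [h.E_F_pow, ← h1, map_smul, lowestCoord, Module.Basis.coord_apply, Module.Basis.repr_self,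
      Finsupp.single_eq_of_ne]
    · simp
    · rw [Ne, Fin.mk.injEq]; omega

/-- Eigenspaces of an operator that is diagonal in the basis `F ^ n v`. -/
lemma exists_eq_smul_of_eigen {t : V →ₗ[ℂ] V} {κ : ℕ → ℂ}
    (ht : ∀ n, t ((s.F ^ n) v) = κ n • (s.F ^ n) v) {lam : ℂ} {x : V} (hx : t x = lam • x)
    (hx0 : x ≠ 0) : ∃ n < P.r, lam = κ n := by
  obtain ⟨a, ha⟩ : ∃ a, h.basis.coord a x ≠ 0 := by
    by_contra! hne
    exact hx0 (h.basis.forall_coord_eq_zero_iff.mp hne)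
  have h1 := LinearMap.congr_fun (coord_comp_of_eigen h.basis (t := t) (κ := fun a => κ a)
    (fun a => by rw [h.basis_apply, ht]) a) x
  rw [LinearMap.comp_apply, hx, map_smul, LinearMap.smul_apply] at h1
  exact ⟨a, a.2, mul_right_cancel₀ ha h1⟩

/-- The eigenspaces of `K` have dimension at most one. -/
lemma exists_smul_eq {lam : ℂ} {x y : V} (hx : s.K x = lam • x) (hx0 : x ≠ 0)
    (hy : s.K y = lam • y) : ∃ c : ℂ, c • x = y := by
  obtain ⟨n, hn, rfl⟩ := h.exists_eq_smul_of_eigen h.K_F_pow hx hx0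
  -- The basis vectors have distinct eigenvalues, so an eigenvector has only its `n`-th coordinate.
  have key : ∀ z, s.K z = ((P.q ^ 2)⁻¹ ^ n * P.qpow (i + P.r - 1)) • z →
      z = h.basis.coord ⟨n, hn⟩ z • h.basis ⟨n, hn⟩ := by
    intro z hz
    refine h.basis.ext_elem fun a => ?_
    by_cases ha : a = ⟨n, hn⟩
    · subst ha; simp
    · have h1 := LinearMap.congr_fun (coord_comp_of_eigen h.basis (t := s.K)
        (κ := fun a => (P.q ^ 2)⁻¹ ^ (a : ℕ) * P.qpow (i + P.r - 1))
        (fun a => by rw [h.basis_apply, h.K_F_pow]) a) z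
      rw [LinearMap.comp_apply, hz, map_smul, LinearMap.smul_apply] at h1
      have h2 : h.basis.repr z a = 0 := by
        by_contra hne
        have h3 := mul_right_cancel₀ (P.qpow_ne_zero _) (mul_right_cancel₀ hne h1)
        exact ha (Fin.ext (P.isPrimitiveRoot_q_sq.inv.pow_inj hn a.2 h3).symm)
      simp [h2, ha]
  have hx1 := key x hx
  have hy1 := key y hy
  have hc : h.basis.coord ⟨n, hn⟩ x ≠ 0 := by
    intro h0
    rw [h0, zero_smul] at hx1
    exact hx0 hx1
  refine ⟨h.basis.coord ⟨n, hn⟩ y / h.basis.coord ⟨n, hn⟩ x, ?_⟩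
  refine (congrArg _ hx1).trans ?_
  rw [smul_smul, div_mul_cancel₀ _ hc]
  exact hy1.symm

end IsTypical

/-! ### The models are typical -/

section Models

variable {P : RootData} {V W : Type*} [AddCommGroup V] [Module ℂ V] [AddCommGroup W] [Module ℂ W]

lemma IsModel.isTypical {i : ℂ} (hi : P.Label i) {σ : U P →ₐ[ℂ] Module.End ℂ W} {w : W}
    (h : IsModel (P.tilde i) σ w) : IsTypical (ops σ) i w := by
  obtain ⟨-, hne, hE, hK, hgen⟩ := h
  have hK' : (ops σ).K w = P.qpow (i + P.r - 1) • w := by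
    refine hK.trans ?_
    congr 1
    change P.qpow (i + (P.r - 1)) = _
    rw [add_sub_assoc]
  have key : ∀ a, ∀ x ∈ Submodule.span ℂ (Set.range fun c : Fin P.r => ((ops σ).F ^ (c : ℕ)) w),
      σ a x ∈ Submodule.span ℂ (Set.range fun c : Fin P.r => ((ops σ).F ^ (c : ℕ)) w) := by
    intro a
    induction a using U.induction with
    | hgen g =>
      intro x hx
      rw [← ops_val]
      exact Quad.span_stable (P.qpow_ne_zero _) hE hK' g hx
    | hscalar c =>
      intro x hx
      rw [AlgHom.commutes, Module.algebraMap_end_apply]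
      exact Submodule.smul_mem _ c hx
    | hadd a b ha hb =>
      intro x hx
      rw [map_add]
      exact Submodule.add_mem _ (ha x hx) (hb x hx)
    | hmul a b ha hb =>
      intro x hx
      rw [map_mul]
      exact ha _ (hb x hx)
  refine ⟨hi, hne, hE, hK', fun x _ => ?_⟩
  obtain ⟨a, rfl⟩ := hgen x
  exact key a w (Submodule.subset_span ⟨⟨0, P.r_pos⟩, by simp⟩)

lemma opH_F_pow {ρ : UH P →ₐ[ℂ] Module.End ℂ V} {v : V} {μ : ℂ} (hv : opH ρ v = μ • v) (n : ℕ) :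
    opH ρ (((ops (forgetH ρ)).F ^ n) v) = (μ - 2 * n) • ((ops (forgetH ρ)).F ^ n) v := by
  induction n with
  | zero => simpa using hv
  | succ n ih =>
    rw [pow_succ', Module.End.mul_apply]
    have h := LinearMap.congr_fun (opH_mul_F ρ) (((ops (forgetH ρ)).F ^ n) v)
    simp only [Module.End.mul_apply, LinearMap.add_apply, LinearMap.smul_apply] at h
    rw [h, ih, map_smul, ← add_smul]
    congr 1
    push_cast
    ring

/-- The span of the `F ^ n v` is stable under `H` as well as under `Ū_q(sl₂)` and contains `v ≠ 0`,
so simplicity makes it everything. -/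
lemma IsModelH.isTypical {i : ℂ} (hi : P.Label i) {ρ : UH P →ₐ[ℂ] Module.End ℂ V} {v : V}
    (h : IsModelH i ρ v) : IsTypical (ops (forgetH ρ)) i v := by
  obtain ⟨⟨-, -, hKH⟩, ⟨-, hsimple⟩, hne, hE, hH⟩ := h
  have hE' : (ops (forgetH ρ)).E v = 0 := by
    rw [← hE]
    exact LinearMap.congr_fun (forgetH_gen ρ Gen.E) v
  have hK' : (ops (forgetH ρ)).K v = P.qpow (i + P.r - 1) • v := by
    rw [← hKH _ _ hH]
    exact LinearMap.congr_fun (forgetH_gen ρ Gen.K) v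
  refine ⟨hi, hne, hE', hK', ?_⟩
  set N := Submodule.span ℂ (Set.range fun c : Fin P.r => ((ops (forgetH ρ)).F ^ (c : ℕ)) v)
  have hgen : ∀ (g : Gen) (x), x ∈ N → ρ ((UH.quint P).toQuad.val g) x ∈ N := by
    intro g x hx
    rw [← forgetH_gen, ← ops_val]
    exact Quad.span_stable (P.qpow_ne_zero _) hE' hK' g hx
  have hv : v ∈ N := Submodule.subset_span ⟨⟨0, P.r_pos⟩, by simp⟩
  have hstable : ∀ a, ∀ x ∈ N, ρ a x ∈ N := by
    intro a
    induction a using UH.induction with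
    | hgen g =>
      intro x hx
      cases g with
      | E => exact hgen Gen.E x hx
      | F => exact hgen Gen.F x hx
      | K => exact hgen Gen.K x hx
      | Ki => exact hgen Gen.Ki x hx
      | H =>
        induction hx using Submodule.span_induction with
        | zero => rw [map_zero]; exact Submodule.zero_mem _
        | add x y _ _ hx hy => rw [map_add]; exact Submodule.add_mem _ hx hy
        | smul c x _ hx => rw [map_smul]; exact Submodule.smul_mem _ c hx
        | mem x hx =>
          obtain ⟨c, rfl⟩ := hx
          simp only
          rw [opH_F_pow hH]
          exact Submodule.smul_mem _ _ (Submodule.subset_span ⟨c, rfl⟩)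
    | hscalar c =>
      intro x hx
      rw [AlgHom.commutes, Module.algebraMap_end_apply]
      exact Submodule.smul_mem _ c hx
    | hadd a b ha hb =>
      intro x hx
      rw [map_add]
      exact Submodule.add_mem _ (ha x hx) (hb x hx)
    | hmul a b ha hb =>
      intro x hx
      rw [map_mul]
      exact ha _ (hb x hx)
  rcases hsimple N hstable with h0 | h1
  · rw [h0, Submodule.mem_bot] at hv
    exact absurd hv hne
  · exact h1.ge

lemma mem_hom_of_gen {σ : U P →ₐ[ℂ] Module.End ℂ V} {τ : U P →ₐ[ℂ] Module.End ℂ W}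
    {f : V →ₗ[ℂ] W} (hf : ∀ g x, f (σ (U.gen P g) x) = τ (U.gen P g) (f x)) : f ∈ Hom σ τ := by
  intro a
  induction a using U.induction with
  | hgen g => exact hf g
  | hscalar c => intro x; simp [AlgHom.commutes, Module.algebraMap_end_apply]
  | hadd a b ha hb => intro x; simp [ha, hb]
  | hmul a b ha hb => intro x; simp [ha, hb]

/-- Typical modules with the same label are isomorphic by a unique isomorphism that preserves the
highest weight vectors. -/
theorem existsUnique_isPointedIso {σ : U P →ₐ[ℂ] Module.End ℂ V} {τ : U P →ₐ[ℂ] Module.End ℂ W}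
    {i : ℂ} {v : V} {w : W} (hv : IsTypical (ops σ) i v) (hw : IsTypical (ops τ) i w) :
    ∃! f : Hom σ τ, IsPointedIso v w f := by
  let f : V ≃ₗ[ℂ] W := hv.basis.equiv hw.basis (Equiv.refl _)
  have hf : ∀ n, f (((ops σ).F ^ n) v) = ((ops τ).F ^ n) w := by
    intro n
    by_cases hn : n < P.r
    · have h1 := hv.basis_apply ⟨n, hn⟩
      have h2 := hw.basis_apply ⟨n, hn⟩
      simp only at h1 h2
      rw [← h1, ← h2, Module.Basis.equiv_apply, Equiv.refl_apply]
    · rw [pow_eq_zero_of_le (not_lt.mp hn) (ops σ).F_pow,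
        pow_eq_zero_of_le (not_lt.mp hn) (ops τ).F_pow]
      simp
  have hmem : f.toLinearMap ∈ Hom σ τ := by
    refine mem_hom_of_gen fun g x => ?_
    rw [← ops_val, ← ops_val]
    have : f.toLinearMap ∘ₗ (ops σ).val g = (ops τ).val g ∘ₗ f.toLinearMap := by
      refine hv.basis.ext fun a => ?_
      obtain ⟨n, hn⟩ := a
      rw [hv.basis_apply, LinearMap.comp_apply, LinearMap.comp_apply, LinearEquiv.coe_coe, hf]
      cases g with
      | E =>
        change f ((ops σ).E (((ops σ).F ^ n) v)) = (ops τ).E (((ops τ).F ^ n) w)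
        cases n with
        | zero => simpa [hv.E_apply] using hw.E_apply.symm
        | succ n => rw [hv.E_F_pow, hw.E_F_pow, map_smul, hf]
      | F =>
        change f ((ops σ).F (((ops σ).F ^ n) v)) = (ops τ).F (((ops τ).F ^ n) w)
        rw [← Module.End.mul_apply, ← Module.End.mul_apply, ← pow_succ', ← pow_succ', hf]
      | K =>
        change f ((ops σ).K (((ops σ).F ^ n) v)) = (ops τ).K (((ops τ).F ^ n) w)
        rw [hv.K_F_pow, hw.K_F_pow, map_smul, hf]
      | Ki =>
        change f ((ops σ).Ki (((ops σ).F ^ n) v)) = (ops τ).Ki (((ops τ).F ^ n) w)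
        rw [hv.Ki_F_pow, hw.Ki_F_pow, map_smul, hf]
    exact LinearMap.congr_fun this x
  refine ⟨⟨f.toLinearMap, hmem⟩, ⟨f.bijective, by simpa using hf 0⟩, ?_⟩
  rintro ⟨g, hg⟩ ⟨-, hgv⟩
  refine Subtype.ext (hv.basis.ext fun a => ?_)
  rw [hv.basis_apply]
  refine Eq.trans ?_ (hf a).symm
  change g v = w at hgv
  -- A morphism is determined by its value on `v`, because it commutes with the powers of `F`.
  have h1 := hg ((U.quad P).F ^ (a : ℕ)) v
  rw [map_pow, map_pow, hgv] at h1
  exact h1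

end Models

/-! ### Invariants -/

section Invariants

variable {P : RootData} {X V : Type*} [AddCommGroup X] [Module ℂ X] [AddCommGroup V] [Module ℂ V]
  {σ : U P →ₐ[ℂ] Module.End ℂ X} {τ : U P →ₐ[ℂ] Module.End ℂ V} {i : ℂ} {v : V}

/-- Pulling the invertible factor `K⁻¹ ⊗ 1` out of `K⁻¹ ⊗ F + F ⊗ 1` leaves `1 ⊗ F + K F ⊗ 1`, to
which the kernel computation applies. -/
lemma ops_tensorRep_F_eq_mixed : (ops (tensorRep σ τ)).F
    = TensorProduct.map (ops σ).Ki LinearMap.id ∘ₗ mixed ((ops σ).K * (ops σ).F) (ops τ).F := by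
  rw [ops_tensorRep_F, mixed, LinearMap.comp_add, ← TensorProduct.map_comp, ← TensorProduct.map_comp,
    ← Module.End.mul_eq_comp (ops σ).Ki ((ops σ).K * _), ← mul_assoc, (ops σ).Ki_K]
  simp

/-- Here the invertible factor is `1 ⊗ K`, and the shift on the second tensor factor becomes `K⁻¹
E`. -/
lemma ops_tensorRep_E_eq_mixed : (ops (tensorRep σ τ)).E
    = TensorProduct.map LinearMap.id (ops τ).K ∘ₗ mixed (ops σ).E ((ops τ).Ki * (ops τ).E) := by
  rw [ops_tensorRep_E, mixed, LinearMap.comp_add, ← TensorProduct.map_comp, ← TensorProduct.map_comp,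
    ← Module.End.mul_eq_comp (ops τ).K ((ops τ).Ki * _), ← mul_assoc, (ops τ).K_Ki]
  simp

lemma ops_tensorRep_F_apply_eq_zero_iff (y : X ⊗[ℂ] V) : (ops (tensorRep σ τ)).F y = 0 ↔
    mixed ((ops σ).K * (ops σ).F) (ops τ).F y = 0 := by
  rw [ops_tensorRep_F_eq_mixed, LinearMap.comp_apply]
  refine ⟨fun h => ?_, fun h => by rw [h, map_zero]⟩
  have h1 := congrArg (TensorProduct.map (ops σ).K (LinearMap.id (M := V))) h
  rw [← LinearMap.comp_apply, ← TensorProduct.map_comp, ← Module.End.mul_eq_comp, (ops σ).K_Ki,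
    map_zero] at h1
  simpa [Module.End.one_eq_id] using h1

lemma ops_tensorRep_E_apply_eq_zero_iff (y : X ⊗[ℂ] V) : (ops (tensorRep σ τ)).E y = 0 ↔
    mixed (ops σ).E ((ops τ).Ki * (ops τ).E) y = 0 := by
  rw [ops_tensorRep_E_eq_mixed, LinearMap.comp_apply]
  refine ⟨fun h => ?_, fun h => by rw [h, map_zero]⟩
  have h1 := congrArg (TensorProduct.map (LinearMap.id (M := X)) (ops τ).Ki) h
  rw [← LinearMap.comp_apply, ← TensorProduct.map_comp, ← Module.End.mul_eq_comp (ops τ).Ki, (ops τ).Ki_K,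
    map_zero] at h1
  simpa [Module.End.one_eq_id] using h1

namespace IsTypical

variable (h : IsTypical (ops τ) i v)

lemma eq_zero_of_F (y : X ⊗[ℂ] V) (hy : (ops (tensorRep σ τ)).F y = 0)
    (htop : contract X h.lowestCoord y = 0) : y = 0 :=
  eq_zero_of_mixed_eq_zero h.basis h.basis_apply P.r_pos (ops τ).F_pow
    ((ops_tensorRep_F_apply_eq_zero_iff y).mp hy) htop

lemma exists_F (x : X) : ∃ y : X ⊗[ℂ] V, (ops (tensorRep σ τ)).F y = 0 ∧
    contract X h.lowestCoord y = x := by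
  obtain ⟨y, hy, hx⟩ := exists_mixed_eq_zero (N := (ops σ).K * (ops σ).F) h.basis h.basis_apply
    P.r_pos (ops τ).F_pow (mul_pow_eq_zero (ops σ).KF (ops σ).F_pow) x
  exact ⟨y, (ops_tensorRep_F_apply_eq_zero_iff y).mpr hy, hx⟩

lemma eq_zero_of_E (y : X ⊗[ℂ] V) (hy : (ops (tensorRep σ τ)).E y = 0)
    (htop : contract X h.highestCoord y = 0) : y = 0 :=
  eq_zero_of_mixed_eq_zero h.lowestBasis h.lowestBasis_apply P.r_pos
    (mul_pow_eq_zero (ops τ).EKi (ops τ).E_pow)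
    ((ops_tensorRep_E_apply_eq_zero_iff y).mp hy) htop

lemma exists_E (x : X) : ∃ y : X ⊗[ℂ] V, (ops (tensorRep σ τ)).E y = 0 ∧
    contract X h.highestCoord y = x := by
  obtain ⟨y, hy, hx⟩ := exists_mixed_eq_zero (N := (ops σ).E) h.lowestBasis h.lowestBasis_apply
    P.r_pos (mul_pow_eq_zero (ops τ).EKi (ops τ).E_pow) (ops σ).E_pow x
  exact ⟨y, (ops_tensorRep_E_apply_eq_zero_iff y).mpr hy, hx⟩

/-- No vector of the form `E w` has a lowest weight component, so only the summand `E ⊗ K` of `Δ E`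
contributes. Taking the lowest coefficient thus carries the condition `E y = 0` over to `X`. -/
lemma contract_lowest_E (y : X ⊗[ℂ] V) :
    contract X h.lowestCoord ((ops (tensorRep σ τ)).E y)
      = ((P.q ^ 2)⁻¹ ^ (P.r - 1) * P.qpow (i + P.r - 1)) •
        (ops σ).E (contract X h.lowestCoord y) := by
  rw [ops_tensorRep_E, LinearMap.add_apply, map_add, contract_map, contract_map,
    h.lowestCoord_comp_E, h.lowestCoord_comp h.K_F_pow, contract_zero, contract_smul, map_zero,
    zero_add, map_smul]

lemma contract_lowest_K (y : X ⊗[ℂ] V) :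
    contract X h.lowestCoord ((ops (tensorRep σ τ)).K y)
      = ((P.q ^ 2)⁻¹ ^ (P.r - 1) * P.qpow (i + P.r - 1)) •
        (ops σ).K (contract X h.lowestCoord y) := by
  rw [ops_tensorRep_K, contract_map, h.lowestCoord_comp h.K_F_pow, contract_smul, map_smul]

lemma contract_highest_K (y : X ⊗[ℂ] V) :
    contract X h.highestCoord ((ops (tensorRep σ τ)).K y)
      = P.qpow (i + P.r - 1) • (ops σ).K (contract X h.highestCoord y) := by
  rw [ops_tensorRep_K, contract_map, h.highestCoord_comp h.K_F_pow, contract_smul, map_smul,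
    pow_zero, one_mul]

end IsTypical

end Invariants

/-! ### Invariants of triple tensor products -/

section Triple

variable {P : RootData}

namespace RootData

variable (P : RootData)

/-- The eigenvalue of `K` on the vector of `V_i` that determines an invariant of
`V_i ⊗ V_j ⊗ V_k`. -/
def invariantWeight (j k : ℂ) : ℂ :=
  (P.qpow (j + P.r - 1) * ((P.q ^ 2)⁻¹ ^ (P.r - 1) * P.qpow (k + P.r - 1)))⁻¹

lemma lowest_ne_zero (k : ℂ) : (P.q ^ 2)⁻¹ ^ (P.r - 1) * P.qpow (k + P.r - 1) ≠ 0 :=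
  mul_ne_zero (pow_ne_zero _ (inv_ne_zero (pow_ne_zero 2 P.q_ne_zero))) (P.qpow_ne_zero _)

end RootData

section Uniqueness

variable {V₁ V₂ V₃ : Type*} [AddCommGroup V₁] [Module ℂ V₁] [AddCommGroup V₂] [Module ℂ V₂]
  [AddCommGroup V₃] [Module ℂ V₃]
  {σ₁ : U P →ₐ[ℂ] Module.End ℂ V₁} {σ₂ : U P →ₐ[ℂ] Module.End ℂ V₂}
  {σ₃ : U P →ₐ[ℂ] Module.End ℂ V₃} {i j k : ℂ} {v₁ : V₁} {v₂ : V₂} {v₃ : V₃}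

/-- The vector of `V₁` that determines an invariant of `V₁ ⊗ V₂ ⊗ V₃`. -/
def leading (h₂ : IsTypical (ops σ₂) j v₂) (h₃ : IsTypical (ops σ₃) k v₃) :
    (V₁ ⊗[ℂ] V₂) ⊗[ℂ] V₃ →ₗ[ℂ] V₁ :=
  contract V₁ h₂.highestCoord ∘ₗ contract (V₁ ⊗[ℂ] V₂) h₃.lowestCoord

lemma mult_apply (f : Mult σ₁ σ₂ σ₃) :
    (ops (tensorRep (tensorRep σ₁ σ₂) σ₃)).E (f.1 1) = 0 ∧
    (ops (tensorRep (tensorRep σ₁ σ₂) σ₃)).F (f.1 1) = 0 ∧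
    (ops (tensorRep (tensorRep σ₁ σ₂) σ₃)).K (f.1 1) = f.1 1 := by
  have key : ∀ g : Gen, tensorRep (tensorRep σ₁ σ₂) σ₃ (U.gen P g) (f.1 1)
      = (Quad.eps P).val g • f.1 1 := by
    intro g
    rw [← f.2, unitRep, AlgHom.comp_apply, counit_gen, ← map_smul]
    simp [Algebra.ofId_apply, Module.algebraMap_end_apply]
  refine ⟨(key Gen.E).trans ?_, (key Gen.F).trans ?_, (key Gen.K).trans ?_⟩ <;>
  simp [Quad.val, Quad.eps]

lemma leading_apply (h₂ : IsTypical (ops σ₂) j v₂) (h₃ : IsTypical (ops σ₃) k v₃)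
    (y : (V₁ ⊗[ℂ] V₂) ⊗[ℂ] V₃) : leading h₂ h₃ y
      = contract V₁ h₂.highestCoord (contract (V₁ ⊗[ℂ] V₂) h₃.lowestCoord y) := rfl

/-- Two kernel arguments in a row: the lowest coefficient in `V₃` detects the kernel of `F`; this
coefficient is killed by `E`, so it is detected in turn by its highest coefficient in `V₂`. -/
lemma eq_zero_of_leading (h₂ : IsTypical (ops σ₂) j v₂) (h₃ : IsTypical (ops σ₃) k v₃)
    {y : (V₁ ⊗[ℂ] V₂) ⊗[ℂ] V₃} (hE : (ops (tensorRep (tensorRep σ₁ σ₂) σ₃)).E y = 0)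
    (hF : (ops (tensorRep (tensorRep σ₁ σ₂) σ₃)).F y = 0) (hy : leading h₂ h₃ y = 0) : y = 0 := by
  have h1 := h₃.contract_lowest_E (σ := tensorRep σ₁ σ₂) y
  rw [hE, map_zero] at h1
  exact h₃.eq_zero_of_F _ hF (h₂.eq_zero_of_E _
    ((smul_eq_zero.mp h1.symm).resolve_left (P.lowest_ne_zero k)) hy)

lemma K_leading (h₂ : IsTypical (ops σ₂) j v₂) (h₃ : IsTypical (ops σ₃) k v₃)
    (f : Mult σ₁ σ₂ σ₃) : (ops σ₁).K (leading h₂ h₃ (f.1 1))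
      = P.invariantWeight j k • leading h₂ h₃ (f.1 1) := by
  obtain ⟨-, -, hK⟩ := mult_apply f
  have h1 := congrArg (leading h₂ h₃) hK
  rw [leading_apply, h₃.contract_lowest_K, map_smul, h₂.contract_highest_K,
    smul_smul, ← leading_apply, mul_comm] at h1
  refine Eq.trans ?_ (congrArg _ h1)
  rw [RootData.invariantWeight, smul_smul, inv_mul_cancel₀, one_smul]
  exact mul_ne_zero (P.qpow_ne_zero _) (P.lowest_ne_zero k)

/-- The space of invariants is at most one-dimensional. -/
lemma exists_smul_eq_of_mult (h₁ : IsTypical (ops σ₁) i v₁) (h₂ : IsTypical (ops σ₂) j v₂)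
    (h₃ : IsTypical (ops σ₃) k v₃) {f : Mult σ₁ σ₂ σ₃} (hf : f.1 1 ≠ 0) (g : Mult σ₁ σ₂ σ₃) :
    ∃ c : ℂ, c • f = g := by
  obtain ⟨hfE, hfF, -⟩ := mult_apply f
  obtain ⟨hgE, hgF, -⟩ := mult_apply g
  obtain ⟨c, hc⟩ := h₁.exists_smul_eq (K_leading h₂ h₃ f)
    (fun h => hf (eq_zero_of_leading h₂ h₃ hfE hfF h)) (K_leading h₂ h₃ g)
  refine ⟨c, Subtype.ext (LinearMap.ext_ring ?_)⟩
  change c • f.1 1 = g.1 1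
  rw [← sub_eq_zero]
  -- The scalar was chosen in the one-dimensional eigenspace of `K` on `V₁` so that the leading
  -- vectors cancel.
  refine eq_zero_of_leading (σ₁ := σ₁) h₂ h₃ ?_ ?_ ?_
  · rw [map_sub, map_smul, hfE, hgE, smul_zero, sub_zero]
  · rw [map_sub, map_smul, hfF, hgF, smul_zero, sub_zero]
  · rw [map_sub, map_smul, hc, sub_self]

end Uniqueness

section Existence

variable {X V : Type*} [AddCommGroup X] [Module ℂ X] [AddCommGroup V] [Module ℂ V]
  {π : UH P →ₐ[ℂ] Module.End ℂ X} {ρ : UH P →ₐ[ℂ] Module.End ℂ V} {i : ℂ} {v : V}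
  (h : IsTypical (ops (forgetH ρ)) i v) (hH : opH ρ v = (i + P.r - 1) • v)

include hH

lemma contract_lowest_H (y : X ⊗[ℂ] V) :
    contract X h.lowestCoord (opH (tensorRep π ρ) y) = opH π (contract X h.lowestCoord y)
      + (i - P.r + 1) • contract X h.lowestCoord y := by
  -- The weight of the lowest weight vector `F ^ (r - 1) v`.
  have e : (i + P.r - 1) - 2 * ((P.r - 1 : ℕ) : ℂ) = i - P.r + 1 := by
    rw [Nat.cast_sub P.one_lt.le]
    push_cast
    ring
  rw [opH_tensorRep, LinearMap.add_apply, map_add, contract_map, contract_map,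
    h.lowestCoord_comp (opH_F_pow hH), contract_smul, e]
  simp

lemma contract_highest_H (y : X ⊗[ℂ] V) :
    contract X h.highestCoord (opH (tensorRep π ρ) y) = opH π (contract X h.highestCoord y)
      + (i + P.r - 1) • contract X h.highestCoord y := by
  rw [opH_tensorRep, LinearMap.add_apply, map_add, contract_map, contract_map,
    h.highestCoord_comp (opH_F_pow hH), contract_smul]
  simp

include h

/-- The lift of `z` to the kernel of `E` is a weight vector by uniqueness: `K` and `H` preserve this
kernel, so each eigenvalue equation need only be checked on the highest coefficient. -/
lemma exists_highest {lam μ : ℂ} {z : X} (hK : (ops (forgetH π)).K z = lam • z)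
    (hz : opH π z = μ • z) : ∃ x : X ⊗[ℂ] V, contract X h.highestCoord x = z ∧
      (ops (forgetH (tensorRep π ρ))).E x = 0 ∧
      (ops (forgetH (tensorRep π ρ))).K x = (P.qpow (i + P.r - 1) * lam) • x ∧
      opH (tensorRep π ρ) x = (μ + (i + P.r - 1)) • x := by
  obtain ⟨x, hE, hx⟩ := h.exists_E (σ := forgetH π) z
  refine ⟨x, hx, ?_⟩
  have hHE := LinearMap.congr_fun (opH_mul_E (tensorRep π ρ)) x
  rw [forgetH_tensorRep] at hHE ⊢
  refine ⟨hE, ?_, ?_⟩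
  · rw [← sub_eq_zero]
    refine h.eq_zero_of_E (σ := forgetH π) _ ?_ ?_
    · have h1 := LinearMap.congr_fun (ops (tensorRep (forgetH π) (forgetH ρ))).KE x
      simp only [Module.End.mul_apply, LinearMap.smul_apply, hE, map_zero] at h1
      rw [map_sub, map_smul, hE, smul_zero, sub_zero]
      exact (smul_eq_zero.mp h1.symm).resolve_left (pow_ne_zero 2 P.q_ne_zero)
    · rw [map_sub, h.contract_highest_K, map_smul, hx, hK, smul_smul, sub_self]
  · rw [← sub_eq_zero]
    refine h.eq_zero_of_E (σ := forgetH π) _ ?_ ?_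
    · simp only [Module.End.mul_apply, LinearMap.add_apply, LinearMap.smul_apply, hE, map_zero,
        smul_zero, add_zero] at hHE
      rw [map_sub, map_smul, hE, smul_zero, sub_zero, ← hHE]
    · rw [map_sub, contract_highest_H h hH, map_smul, hx, hz, add_smul, sub_self]

/-- The weight of `x` is opposite to the lowest weight of `V`, so the lift `y` of `x` to the kernel
of `F` has weight zero. Invariance under `E` must come after `K y = y`: only then does `[E, F] y =
0` show that `E y` lies in the kernel of `F`, where its lowest coefficient, a multiple of `E x`,
decides. -/
lemma exists_invariant {x : X} (hE : (ops (forgetH π)).E x = 0)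
    (hK : (ops (forgetH π)).K x = ((P.q ^ 2)⁻¹ ^ (P.r - 1) * P.qpow (i + P.r - 1))⁻¹ • x)
    (hx : opH π x = -(i - P.r + 1) • x) : ∃ y : X ⊗[ℂ] V, contract X h.lowestCoord y = x ∧
      (ops (forgetH (tensorRep π ρ))).E y = 0 ∧ (ops (forgetH (tensorRep π ρ))).F y = 0 ∧
      (ops (forgetH (tensorRep π ρ))).K y = y ∧ opH (tensorRep π ρ) y = 0 := by
  obtain ⟨y, hF, hy⟩ := h.exists_F (σ := forgetH π) x
  refine ⟨y, hy, ?_⟩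
  have hHF := LinearMap.congr_fun (opH_mul_F (tensorRep π ρ)) y
  rw [forgetH_tensorRep] at hHF ⊢
  have hKy : (ops (tensorRep (forgetH π) (forgetH ρ))).K y = y := by
    rw [← sub_eq_zero]
    refine h.eq_zero_of_F (σ := forgetH π) _ ?_ ?_
    · have h1 := LinearMap.congr_fun (ops (tensorRep (forgetH π) (forgetH ρ))).KF y
      simp only [Module.End.mul_apply, LinearMap.smul_apply, hF, map_zero] at h1
      rw [map_sub, hF, sub_zero]
      exact (smul_eq_zero.mp h1.symm).resolve_left
        (inv_ne_zero (pow_ne_zero 2 P.q_ne_zero))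
    · rw [map_sub, h.contract_lowest_K, hy, hK, smul_smul, mul_inv_cancel₀ (P.lowest_ne_zero i),
        one_smul, sub_self]
  refine ⟨?_, hF, hKy, ?_⟩
  · refine h.eq_zero_of_F (σ := forgetH π) _ ?_ ?_
    · have h1 := LinearMap.congr_fun (ops (tensorRep (forgetH π) (forgetH ρ))).E_F y
      have hKi := (ops (tensorRep (forgetH π) (forgetH ρ))).Ki_apply_of_eigen one_ne_zero
        (hKy.trans (one_smul ℂ y).symm)
      rw [inv_one, one_smul] at hKi
      simp only [LinearMap.sub_apply, Module.End.mul_apply, LinearMap.smul_apply, hF, map_zero,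
        hKy, hKi, sub_self, smul_zero, zero_sub, neg_eq_zero] at h1
      exact h1
    · rw [h.contract_lowest_E, hy, hE, smul_zero]
  · refine h.eq_zero_of_F (σ := forgetH π) _ ?_ ?_
    · simp only [Module.End.mul_apply, LinearMap.add_apply, LinearMap.smul_apply, hF, map_zero,
        smul_zero, add_zero] at hHF
      exact hHF.symm
    · rw [contract_lowest_H h hH, hy, hx, ← add_smul, neg_add_cancel, zero_smul]

end Existence

section Main

variable {V₁ V₂ V₃ : Type*} [AddCommGroup V₁] [Module ℂ V₁] [AddCommGroup V₂] [Module ℂ V₂]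
  [AddCommGroup V₃] [Module ℂ V₃]
  {ρ₁ : UH P →ₐ[ℂ] Module.End ℂ V₁} {ρ₂ : UH P →ₐ[ℂ] Module.End ℂ V₂}
  {ρ₃ : UH P →ₐ[ℂ] Module.End ℂ V₃} {i j k : ℂ} {v₁ : V₁} {v₂ : V₂} {v₃ : V₃}

lemma multH_H_apply (f : MultH ρ₁ ρ₂ ρ₃) : opH (tensorRep (tensorRep ρ₁ ρ₂) ρ₃) (f.1 1) = 0 := by
  rw [opH, ← f.2, unitRep, AlgHom.comp_apply, counitH_gen]
  simp [Quint.val, Quint.eps]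

lemma mem_multH {y : (V₁ ⊗[ℂ] V₂) ⊗[ℂ] V₃}
    (hE : (ops (forgetH (tensorRep (tensorRep ρ₁ ρ₂) ρ₃))).E y = 0)
    (hF : (ops (forgetH (tensorRep (tensorRep ρ₁ ρ₂) ρ₃))).F y = 0)
    (hK : (ops (forgetH (tensorRep (tensorRep ρ₁ ρ₂) ρ₃))).K y = y)
    (hH : opH (tensorRep (tensorRep ρ₁ ρ₂) ρ₃) y = 0) :
    LinearMap.toSpanSingleton ℂ _ y ∈ MultH ρ₁ ρ₂ ρ₃ := by
  have hKi := (ops (forgetH (tensorRep (tensorRep ρ₁ ρ₂) ρ₃))).Ki_apply_of_eigen one_ne_zero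
    (hK.trans (one_smul ℂ y).symm)
  rw [inv_one, one_smul] at hKi
  have hgen : ∀ g : Gen, tensorRep (tensorRep ρ₁ ρ₂) ρ₃ ((UH.quint P).toQuad.val g) y
      = (ops (forgetH (tensorRep (tensorRep ρ₁ ρ₂) ρ₃))).val g y := by
    intro g
    rw [← forgetH_gen, ops_val]
  have key : ∀ a, tensorRep (tensorRep ρ₁ ρ₂) ρ₃ a y
      = Bialgebra.counitAlgHom ℂ (UH P) a • y := by
    intro a
    induction a using UH.induction with
    | hgen g =>
      rw [counitH_gen]
      cases g with
      | E => exact (hgen Gen.E).trans (hE.trans (zero_smul ℂ y).symm)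
      | F => exact (hgen Gen.F).trans (hF.trans (zero_smul ℂ y).symm)
      | K => exact (hgen Gen.K).trans (hK.trans (one_smul ℂ y).symm)
      | Ki => exact (hgen Gen.Ki).trans (hKi.trans (one_smul ℂ y).symm)
      | H => exact hH.trans (zero_smul ℂ y).symm
    | hscalar c => rw [AlgHom.commutes, AlgHom.commutes]; rfl
    | hadd a b ha hb => rw [map_add, map_add, add_smul, LinearMap.add_apply, ha, hb]
    | hmul a b ha hb =>
      rw [map_mul, map_mul, Module.End.mul_apply, hb, map_smul, ha, smul_smul, mul_comm]
  intro a c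
  rw [LinearMap.toSpanSingleton_apply, LinearMap.toSpanSingleton_apply, map_smul, key, unitRep,
    AlgHom.comp_apply, Algebra.ofId_apply, Module.algebraMap_end_apply, smul_smul, smul_eq_mul,
    mul_comm]

/-- The heights are the numbers `2 n - (r - 1)` with `0 ≤ n < r`. -/
lemma RootData.mem_heights_iff (x : ℂ) :
    x ∈ P.heights ↔ ∃ n < P.r, x = 2 * (n : ℂ) - P.r + 1 := by
  obtain ⟨t, ht⟩ := P.odd_r
  have hr' : P.r' = t := by rw [RootData.r']; omega
  simp only [RootData.heights, Set.mem_ofPred_eq, hr', ht]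
  constructor
  · rintro ⟨l, h1, h2, rfl⟩
    -- With `r = 2t + 1`, the height `2l` equals `2n - 2t` for `n = l + t`.
    refine ⟨(l + t).toNat, by omega, ?_⟩
    have e : (((l + t).toNat : ℤ) : ℂ) = ((l + t : ℤ) : ℂ) := by
      rw [Int.toNat_of_nonneg (by omega)]
    rw [Int.cast_natCast] at e
    rw [e]
    push_cast
    ring
  · rintro ⟨n, hn, rfl⟩
    refine ⟨n - t, by omega, by omega, ?_⟩
    push_cast
    ring

variable (h₁ : IsTypical (ops (forgetH ρ₁)) i v₁) (h₂ : IsTypical (ops (forgetH ρ₂)) j v₂)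
  (h₃ : IsTypical (ops (forgetH ρ₃)) k v₃) (H₁ : opH ρ₁ v₁ = (i + P.r - 1) • v₁)
  (H₂ : opH ρ₂ v₂ = (j + P.r - 1) • v₂) (H₃ : opH ρ₃ v₃ = (k + P.r - 1) • v₃)

include h₁ h₂ h₃ H₁ H₂ H₃

/-- Nonzero invariants exist only for heights in `{-2r', …, 2r'}`. -/
theorem multH_eq_bot (hn : i + j + k ∉ P.heights) : MultH ρ₁ ρ₂ ρ₃ = ⊥ := by
  refine (Submodule.eq_bot_iff _).mpr fun f hf => ?_
  by_contra hf0
  have hz0 : leading h₂ h₃ (f 1) ≠ 0 := by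
    intro h0
    obtain ⟨hE, hF, -⟩ := mult_apply (forgetMult ρ₁ ρ₂ ρ₃ ⟨f, hf⟩)
    exact hf0 (LinearMap.ext_ring (eq_zero_of_leading h₂ h₃ hE hF h0))
  have hH := congrArg (leading h₂ h₃) (multH_H_apply ⟨f, hf⟩)
  rw [leading_apply, contract_lowest_H h₃ H₃, map_add, map_smul,
    contract_highest_H h₂ H₂, map_zero, ← leading_apply, add_assoc,
    ← add_smul] at hH
  -- The lowest weight `k - r + 1` and the highest weight `j + r - 1` add up to `j + k`.
  have hz : opH ρ₁ (leading h₂ h₃ (f 1)) = -(j + k) • leading h₂ h₃ (f 1) := by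
    rw [eq_neg_of_add_eq_zero_left hH, ← neg_smul]
    congr 1
    ring
  obtain ⟨n, hn', he⟩ := h₁.exists_eq_smul_of_eigen (opH_F_pow H₁) hz hz0
  exact hn ((P.mem_heights_iff _).mpr ⟨n, hn', by linear_combination -he⟩)

/-- For heights in `{-2r', …, 2r'}` there is a nonzero invariant. -/
theorem exists_multH_ne_zero (hn : i + j + k ∈ P.heights) : ∃ f : MultH ρ₁ ρ₂ ρ₃, f.1 1 ≠ 0 := by
  obtain ⟨n, hnr, hn⟩ := (P.mem_heights_iff _).mp hn
  have hz0 := h₁.F_pow_ne_zero n hnr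
  -- The height condition says exactly that `F ^ n v₁` has weight `i + r - 1 - 2n = -(j + k)`, so it
  -- can serve as leading vector.
  obtain ⟨x, hx, hxE, hxK, hxH⟩ := exists_highest h₂ H₂ (h₁.K_F_pow n) (opH_F_pow H₁ n)
  have hq : ∀ n : ℕ, (P.q ^ 2)⁻¹ ^ n = P.qpow (-(2 * n)) := by
    intro n
    have e : (2 * n : ℂ) = ((2 * n : ℕ) : ℂ) := by push_cast; rfl
    rw [P.qpow_neg, e, P.qpow_natCast, inv_pow, pow_mul]
  have e : ((P.r - 1 : ℕ) : ℂ) = P.r - 1 := by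
    rw [Nat.cast_sub P.one_lt.le, Nat.cast_one]
  rw [hq, ← P.qpow_add, ← P.qpow_add] at hxK
  obtain ⟨y, hy, hyE, hyF, hyK, hyH⟩ := exists_invariant h₃ H₃ hxE
    (by
      rw [hxK, hq, ← P.qpow_add, ← P.qpow_neg, e]
      congr 2
      linear_combination hn)
    (by
      rw [hxH]
      congr 1
      linear_combination hn)
  refine ⟨⟨_, mem_multH hyE hyF hyK hyH⟩, fun h0 => ?_⟩
  rw [LinearMap.toSpanSingleton_apply, one_smul] at h0
  rw [h0, map_zero] at hy
  rw [← hy, map_zero] at hx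
  exact hz0 hx.symm

end Main

end Triple

/-! ### Comparison of invariants with and without `H` -/

section Comparison

variable {P : RootData} {V₁ V₂ V₃ W₁ W₂ W₃ : Type*}
  [AddCommGroup V₁] [Module ℂ V₁] [AddCommGroup V₂] [Module ℂ V₂] [AddCommGroup V₃] [Module ℂ V₃]
  [AddCommGroup W₁] [Module ℂ W₁] [AddCommGroup W₂] [Module ℂ W₂] [AddCommGroup W₃] [Module ℂ W₃]
  {ρ₁ : UH P →ₐ[ℂ] Module.End ℂ V₁} {ρ₂ : UH P →ₐ[ℂ] Module.End ℂ V₂}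
  {ρ₃ : UH P →ₐ[ℂ] Module.End ℂ V₃} {σ₁ : U P →ₐ[ℂ] Module.End ℂ W₁}
  {σ₂ : U P →ₐ[ℂ] Module.End ℂ W₂} {σ₃ : U P →ₐ[ℂ] Module.End ℂ W₃}

lemma finrank_multH_eq_one {i j k : ℂ} {v₁ : V₁} {v₂ : V₂} {v₃ : V₃}
    (h₁ : IsTypical (ops (forgetH ρ₁)) i v₁) (h₂ : IsTypical (ops (forgetH ρ₂)) j v₂)
    (h₃ : IsTypical (ops (forgetH ρ₃)) k v₃) {f : MultH ρ₁ ρ₂ ρ₃} (hf : f.1 1 ≠ 0) :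
    Module.finrank ℂ (MultH ρ₁ ρ₂ ρ₃) = 1 := by
  have hbij : Function.Bijective (LinearMap.toSpanSingleton ℂ (MultH ρ₁ ρ₂ ρ₃) f) := by
    refine ⟨fun c d hcd => ?_, fun g => ?_⟩
    · have h := LinearMap.congr_fun (congrArg Subtype.val hcd) 1
      exact smul_left_injective ℂ hf h
    -- The bound on the dimension is inherited from `Ū_q(sl₂)`, since forgetting `H` keeps the
    -- underlying linear maps.
    · obtain ⟨c, hc⟩ := exists_smul_eq_of_mult h₁ h₂ h₃ (f := forgetMult ρ₁ ρ₂ ρ₃ f) hf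
        (forgetMult ρ₁ ρ₂ ρ₃ g)
      have h : (c • forgetMult ρ₁ ρ₂ ρ₃ f).1 = (forgetMult ρ₁ ρ₂ ρ₃ g).1 := congrArg _ hc
      exact ⟨c, Subtype.ext h⟩
  rw [← (LinearEquiv.ofBijective _ hbij).finrank_eq, Module.finrank_self]

lemma compMult_apply_injective
    {f₁ : Hom (forgetH ρ₁) σ₁} {f₂ : Hom (forgetH ρ₂) σ₂} {f₃ : Hom (forgetH ρ₃) σ₃}
    (h₁ : Function.Bijective f₁.1) (h₂ : Function.Bijective f₂.1) (h₃ : Function.Bijective f₃.1)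
    (f g : MultH ρ₁ ρ₂ ρ₃) (hfg : (compMult f₁ f₂ f₃ f).1 1 = (compMult f₁ f₂ f₃ g).1 1) :
    f.1 1 = g.1 1 := by
  let e := TensorProduct.congr (TensorProduct.congr (LinearEquiv.ofBijective f₁.1 h₁)
    (LinearEquiv.ofBijective f₂.1 h₂)) (LinearEquiv.ofBijective f₃.1 h₃)
  exact e.injective hfg

end Comparison

end QuantumSl2

end

theorem mainTheorem10 (P : RootData) (i j k : ℂ)
    (hi : P.Label i) (hj : P.Label j) (hk : P.Label k)
    {Vi Vj Vk Wi Wj Wk : Type*}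
    [AddCommGroup Vi] [Module ℂ Vi] [AddCommGroup Vj] [Module ℂ Vj]
    [AddCommGroup Vk] [Module ℂ Vk] [AddCommGroup Wi] [Module ℂ Wi]
    [AddCommGroup Wj] [Module ℂ Wj] [AddCommGroup Wk] [Module ℂ Wk]
    (ρi : UH P →ₐ[ℂ] Module.End ℂ Vi) (ρj : UH P →ₐ[ℂ] Module.End ℂ Vj)
    (ρk : UH P →ₐ[ℂ] Module.End ℂ Vk)
    (vi : Vi) (vj : Vj) (vk : Vk)
    (hVi : IsModelH i ρi vi) (hVj : IsModelH j ρj vj) (hVk : IsModelH k ρk vk)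
    (σi : U P →ₐ[ℂ] Module.End ℂ Wi) (σj : U P →ₐ[ℂ] Module.End ℂ Wj)
    (σk : U P →ₐ[ℂ] Module.End ℂ Wk)
    (wi : Wi) (wj : Wj) (wk : Wk)
    (hWi : IsModel (P.tilde i) σi wi) (hWj : IsModel (P.tilde j) σj wj)
    (hWk : IsModel (P.tilde k) σk wk) :
    (∃! f : Hom (forgetH ρi) σi, IsPointedIso vi wi f) ∧
    (∃! f : Hom (forgetH ρj) σj, IsPointedIso vj wj f) ∧
    (∃! f : Hom (forgetH ρk) σk, IsPointedIso vk wk f) ∧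
    (i + j + k ∉ P.heights → MultH ρi ρj ρk = ⊥) ∧
    (i + j + k ∈ P.heights →
      Module.finrank ℂ (MultH ρi ρj ρk) = 1 ∧
      ∀ (fi : Hom (forgetH ρi) σi) (fj : Hom (forgetH ρj) σj) (fk : Hom (forgetH ρk) σk),
        IsPointedIso vi wi fi → IsPointedIso vj wj fj → IsPointedIso vk wk fk →
        Function.Bijective (compMult fi fj fk)) := by
  have tVi := hVi.isTypical hi
  have tVj := hVj.isTypical hj
  have tVk := hVk.isTypical hk
  have tWi := hWi.isTypical hi
  have tWj := hWj.isTypical hj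
  have tWk := hWk.isTypical hk
  refine ⟨existsUnique_isPointedIso tVi tWi, existsUnique_isPointedIso tVj tWj,
    existsUnique_isPointedIso tVk tWk,
    multH_eq_bot tVi tVj tVk hVi.2.2.2.2 hVj.2.2.2.2 hVk.2.2.2.2, fun hh => ?_⟩
  obtain ⟨f, hf⟩ := exists_multH_ne_zero tVi tVj tVk hVi.2.2.2.2 hVj.2.2.2.2 hVk.2.2.2.2 hh
  refine ⟨finrank_multH_eq_one tVi tVj tVk hf, fun fi fj fk hfi hfj hfk => ?_⟩
  have hinj := compMult_apply_injective hfi.1 hfj.1 hfk.1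
  refine ⟨fun g g' h => Subtype.ext (LinearMap.ext_ring (hinj g g' (by rw [h]))), fun g => ?_⟩
  -- Surjectivity: the image of the nonzero invariant `f` is nonzero by injectivity, and it spans a
  -- target of dimension at most one.
  obtain ⟨c, hc⟩ := exists_smul_eq_of_mult tWi tWj tWk (f := compMult fi fj fk f)
    (fun h => hf (hinj f 0 (h.trans (by simp)))) g
  exact ⟨c • f, by rw [map_smul, hc]⟩
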